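/- **Setting.** Let $d\ge 0$, $T\ge 1$ be integers and let $l_0\ge 1$ (integer), $\lambda>0$, $\epsilon\ge 0$, $R\ge 0$, $H$, $L$ be constants with $L\ge\sqrt\lambda$. Let $\theta_\star\in\mathbb R^d$ with $\|\theta_\star\|_2\le H$. In round $t=1,\dots,T$ the learner receives an arm set $\mathcal X_t\subseteq\{x\in\mathbb R^d:\|x\|_2\le L\}$ (possibly depending on the past), selects $x_t\in\mathcal X_t$ and observes $r_t=x_t^\top\theta_\star+z_t$. There is a filtration $(\mathcal F_t)$ such that $x_t$ is $\mathcal F_{t-1}$-measurable, $z_t$ is $\mathcal F_t$-measurable and $z_t$ is conditionally $R$-subgaussian: $\mathbb E[e^{sz_t}\mid\mathcal F_{t-1}]\le e^{s^2R^2/2}$ a.s. for all $s\in\mathbb R$. The regret is $\mathrm{Regret}_T=\sum_{t=1}^T\big(\sup_{x\in\mathcal X_t}x^\top\theta_\star-x_t^\top\theta_\star\big)$. **Dyadic Block Sketching with Robust Frequent Directions (RFD).** A block $i$ has a length $l_i$, a size, a sketch $S_i\in\mathbb R^{l_i\times d}$ and a counter $\alpha_i$; a fresh block has size $0$, $S_i=0$,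 $\alpha_i=0$. The blocks are numbered $1,\dots,B$, block $B$ is the active one, and initially there is one fresh block, with $l_1=l_0$. To *update* a block of length $l$ with a row $x$: put $x$ into the last row of its sketch, take a singular value decomposition $U\Sigma V^\top$ of the resulting $l\times d$ matrix with singular values $\sigma_1\ge\dots\ge\sigma_l\ge0$, replace the sketch by $\sqrt{\Sigma^2-\sigma_l^2I}\,V^\top$, add $\sigma_l^2$ to the counter and $\|x\|_2^2$ to the size. On receiving $x_t$: * if $B-1\ge\lfloor\log_2(d/l_0+1)\rfloor-1$ (block limit), the row is stored exactly: $F\leftarrow F+x_tx_t^\top$, where $F=0$ initially; * otherwise, if the size of the active block plus $\|x_t\|_2^2$ exceeds $\epsilon l_0$ and the active sketch with $x_t$ put into its last row has rank equal to its length (i.e. inserting $x_t$ would cause a nonzero shrinking value), a fresh active block of twice the length is opened and updated with $x_t$; * otherwise the active block is updated with $x_t$. Let $B_t$ be the number of blocks after round $t$, $l_{B_t}$ the length of the active one, $\bar\sigma_i$ the counter of block $i$, and $$\hat A^{(t)}=\lambda I+\sum_{i=1}^{B_t}\bar\sigma_i I+\sum_{i=1}^{B_t}S_i^\top S_i+F,\qquad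 \hat\theta_t=(\hat A^{(t)})^{-1}\sum_{s\le t}r_sx_s .$$ **DBSLinUCB.** Put $\rho_t=2l_{B_t}$ if the block limit is not reached after round $t$, and $\rho_t=\max(2l_{B_t},d)$ otherwise; $h_t=\sum_i\bar\sigma_i-\rho_t^{-1}\sum_i l_i\bar\sigma_i$, and $$\hat\beta_t(\delta)=R\sqrt{2\ln\tfrac1\delta+d\ln\Big(1+\tfrac{\sum_i\bar\sigma_i}{\lambda}\Big)+\rho_t\ln\Big(1+\tfrac{tL^2}{\rho_t\lambda}+\tfrac{h_t}{\lambda}\Big)}+H\sqrt{\lambda+\sum_i\bar\sigma_i}.$$ In round $t$ the algorithm selects $x_t\in\arg\max_{x\in\mathcal X_t}\big\{x^\top\hat\theta_{t-1}+\hat\beta_{t-1}(\delta)\,\|x\|_{(\hat A^{(t-1)})^{-1}}\big\}$, with $\delta=1/T$, where $\|x\|_A=\sqrt{x^\top Ax}$. **Theorem.** There is an absolute constant $C>0$ such that, in this setting, with probability at least $1-\frac1T$, DBSLinUCB using RFD satisfies $$\mathrm{Regret}_T\le C\,\frac{L}{\sqrt\lambda}\,\sqrt T\,\sqrt{2l_{B_T}\Lambda_T}\,\Big(H\sqrt{\lambda+\epsilon}+R\sqrt{d\ln\big(1+\tfrac{\epsilon}{\lambda}\big)+2l_{B_T}\Lambda_T}\Big),$$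 $$\Lambda_T=\ln\Big(1+\frac{TL^2}{2l_{B_T}\lambda}+\Big(1-\frac{2-B_T}{2^{B_T+1}}\Big)\frac{\epsilon}{\lambda}\Big).$$ -/

import Mathlib

open MeasureTheory ProbabilityTheory
open scoped Matrix

namespace DBS

noncomputable section

/-- The Euclidean space `ℝ^d`. -/
abbrev Vec (d : ℕ) : Type := EuclideanSpace ℝ (Fin d)

/-- The matrix norm `‖x‖_A = √(xᵀ A x)`. -/
def matNorm {d : ℕ} (A : Matrix (Fin d) (Fin d) ℝ) (x : Vec d) : ℝ :=
  √(x.ofLp ⬝ᵥ (A *ᵥ x.ofLp))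

/-- Singular value decomposition `Q = U Σ Vᵀ` of an `l × d` matrix: `U` is orthogonal, `V` has
orthonormal columns and the singular values `s` are nonnegative and in descending order. -/
structure IsSVD {l d : ℕ} (Q : Matrix (Fin l) (Fin d) ℝ) (U : Matrix (Fin l) (Fin l) ℝ)
    (s : Fin l → ℝ) (V : Matrix (Fin d) (Fin l) ℝ) : Prop where
  orthogonal_left : Uᵀ * U = 1
  orthonormal_right : Vᵀ * V = 1
  nonneg : ∀ i, 0 ≤ s i
  antitone : Antitone s
  eq_mul : Q = U * Matrix.diagonal s * Vᵀ

/-! ### The Robust Frequent Directions sketch of one block -/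

/-- A block: its length (sketch size), its size (sum of the squared norms of the rows it covers),
its sketch matrix and the counter of its Robust Frequent Directions sketch (the sum of all the
shrinking values so far). -/
structure Block (d : ℕ) where
  len : ℕ
  len_pos : 0 < len
  size : ℝ
  sketch : Matrix (Fin len) (Fin d) ℝ
  counter : ℝ

namespace Block

variable {d : ℕ}

/-- A fresh block of length `l`. -/
def fresh (d l : ℕ) (hl : 0 < l) : Block d :=
  { len := l, len_pos := hl, size := 0, sketch := 0, counter := 0 }

/-- The index of the last row of the sketch matrix. -/
def last (b : Block d) : Fin b.len :=
  ⟨b.len - 1, Nat.sub_lt b.len_pos Nat.one_pos⟩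

/-- The sketch matrix with the new row inserted as its last row. -/
def append (b : Block d) (x : Vec d) : Matrix (Fin b.len) (Fin d) ℝ :=
  b.sketch.updateRow b.last x.ofLp

/-- One update of the Robust Frequent Directions sketch of a block with the row `x`: insert `x` as
the last row, compute a singular value decomposition (any one), shrink by `σ`, the square of the
last singular value, and add `σ` to the counter. -/
def Update (b : Block d) (x : Vec d) (b' : Block d) : Prop :=
  ∃ (U : Matrix (Fin b.len) (Fin b.len) ℝ) (s : Fin b.len → ℝ) (V : Matrix (Fin d) (Fin b.len) ℝ),
    IsSVD (b.append x) U s V ∧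
    b' = { len := b.len
           len_pos := b.len_pos
           size := b.size + ‖x‖ ^ 2
           sketch := Matrix.diagonal (fun i => √(s i ^ 2 - s b.last ^ 2)) * Vᵀ
           counter := b.counter + s b.last ^ 2 }

end Block

/-! ### Dyadic Block Sketching -/

/-- The state of Dyadic Block Sketching: the inactive blocks, the active block, and the sum of the
rank-one terms `xᵀ x` added once the number of blocks has reached its limit. -/
structure State (d : ℕ) where
  inactive : List (Block d)
  active : Block d
  full : Matrix (Fin d) (Fin d) ℝ

namespace State

variable {d : ℕ}

/-- The initial state: one active block of length `l₀`. -/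
def init (d l₀ : ℕ) (h : 0 < l₀) : State d :=
  { inactive := [], active := Block.fresh d l₀ h, full := 0 }

/-- All blocks. -/
def blocks (st : State d) : List (Block d) := st.inactive ++ [st.active]

/-- The number of blocks. -/
def numBlocks (st : State d) : ℕ := st.blocks.length

/-- The sketch size in the active block. -/
def activeLen (st : State d) : ℕ := st.active.len

/-- `SᵀS`, where `S` stacks the sketch matrices of all blocks, together with the rank-one terms. -/
def gram (st : State d) : Matrix (Fin d) (Fin d) ℝ :=
  (st.blocks.map fun b => b.sketchᵀ * b.sketch).sum + st.full

/-- The sum of the counters of all blocks, i.e. the sum of all shrinking values. -/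
def counter (st : State d) : ℝ := (st.blocks.map fun b => b.counter).sum

/-- The block limit is reached: `B ≥ ⌊log₂ (d / l₀ + 1)⌋ - 1`, where the blocks are `0, …, B`. -/
def LimitReached (l₀ : ℕ) (st : State d) : Prop :=
  ⌊Real.logb 2 ((d : ℝ) / l₀ + 1)⌋ - 1 ≤ (st.inactive.length : ℤ)

/-- A new block has to be opened before `x` is inserted: with `x` the size of the active block
would exceed `ε l₀`, and the rank of the sketch with the row `x` would reach the length of the
block, i.e. inserting `x` would cause a nonzero shrinking value. -/
def MustSplit (l₀ : ℕ) (ε : ℝ) (st : State d) (x : Vec d) : Prop :=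
  ε * l₀ < st.active.size + ‖x‖ ^ 2 ∧ st.active.len ≤ (st.active.append x).rank

/-- One round of Dyadic Block Sketching with Robust Frequent Directions. -/
inductive Step (l₀ : ℕ) (ε : ℝ) (st : State d) (x : Vec d) : State d → Prop
  /-- Beyond the block limit the new row is stored exactly, by a rank-one update of `SᵀS`. -/
  | rankOne (h : st.LimitReached l₀) :
      Step l₀ ε st x
        { inactive := st.inactive
          active := st.active
          full := st.full + Matrix.vecMulVec x.ofLp x.ofLp }
  /-- The active block is updated with the new row. -/
  | update (h : ¬ st.LimitReached l₀) (hs : ¬ st.MustSplit l₀ ε x) (b : Block d)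
      (hb : st.active.Update x b) :
      Step l₀ ε st x { inactive := st.inactive, active := b, full := st.full }
  /-- A new active block of twice the length is opened, and updated with the new row. -/
  | split (h : ¬ st.LimitReached l₀) (hs : st.MustSplit l₀ ε x) (b : Block d)
      (hb : (Block.fresh d (2 * st.active.len)
        (Nat.mul_pos Nat.two_pos st.active.len_pos)).Update x b) :
      Step l₀ ε st x
        { inactive := st.inactive ++ [st.active], active := b, full := st.full }

end State

/-! ### DBSLinUCB -/

/-- The input of DBSLinUCB: initial sketch size `l₀`, error parameter `ε`, regularization `lam`,
confidence `δ`, and the problem constants `H`, `L`, `R` that enter the confidence radius. -/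
structure Params where
  l₀ : ℕ
  l₀_pos : 0 < l₀
  ε : ℝ
  lam : ℝ
  δ : ℝ
  H : ℝ
  L : ℝ
  R : ℝ

variable {d : ℕ}

/-- The sketched covariance matrix `Â = SᵀS + (λ + ∑ᵢ αᵢ) I`. -/
def hatA (p : Params) (st : State d) : Matrix (Fin d) (Fin d) ℝ :=
  st.gram + (p.lam + st.counter) • (1 : Matrix (Fin d) (Fin d) ℝ)

open Classical in
/-- The bound on the rank of the sketch used in the confidence radius: `2 l_B` while the rows are
sketched; once they are stored exactly the rank can be `d`, and the bound is `max (2 l_B) d`. -/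
def rankBound (p : Params) (st : State d) : ℕ :=
  if st.LimitReached p.l₀ then max (2 * st.activeLen) d else 2 * st.activeLen

/-- `h = ∑ᵢ σ̄ᵢ - (∑ᵢ lᵢ σ̄ᵢ) / r`, where `r` is the rank bound. -/
def hTerm (p : Params) (st : State d) : ℝ :=
  st.counter - (st.blocks.map fun b => (b.len : ℝ) * b.counter).sum / rankBound p st

/-- The confidence radius `β̂_t(δ)`. -/
def radius (p : Params) (t : ℕ) (st : State d) : ℝ :=
  p.R * √(2 * Real.log (1 / p.δ) + d * Real.log (1 + st.counter / p.lam)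
      + rankBound p st * Real.log (1 + t * p.L ^ 2 / (rankBound p st * p.lam)
          + hTerm p st / p.lam))
    + p.H * √(p.lam + st.counter)

/-- The sketched regularized least squares estimator `θ̂_t = Â⁻¹ ∑_{s ≤ t} r_s x_s`. Round `s + 1`
has index `s`. -/
def hatTheta (p : Params) (st : State d) (x : ℕ → Vec d) (r : ℕ → ℝ) (t : ℕ) : Vec d :=
  WithLp.toLp 2 ((hatA p st)⁻¹ *ᵥ (∑ s ∈ Finset.range t, r s • x s).ofLp)

/-- The upper confidence index of an arm `y` after `t` rounds:
`yᵀ θ̂_t + β̂_t(δ) ‖y‖_{Â⁻¹}`. -/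
def ucb (p : Params) (st : State d) (x : ℕ → Vec d) (r : ℕ → ℝ) (t : ℕ) (y : Vec d) : ℝ :=
  inner ℝ y (hatTheta p st x r t) + radius p t st * matNorm (hatA p st)⁻¹ y

/-- `T` rounds of DBSLinUCB with Robust Frequent Directions. The index `t` stands for round
`t + 1`: `arms t` is its arm set, `x t` the selected arm and `r t` the reward; `st t` is the state
of the sketch after `t` rounds. -/
structure IsRun (p : Params) (T : ℕ) (arms : ℕ → Set (Vec d)) (x : ℕ → Vec d) (r : ℕ → ℝ)
    (st : ℕ → State d) : Prop where
  start : st 0 = State.init d p.l₀ p.l₀_pos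
  mem : ∀ t < T, x t ∈ arms t
  optimistic : ∀ t < T, ∀ y ∈ arms t, ucb p (st t) x r t y ≤ ucb p (st t) x r t (x t)
  step : ∀ t < T, State.Step p.l₀ p.ε (st t) (x t) (st (t + 1))

/-- The regret over `T` rounds. -/
def regret (θ : Vec d) (T : ℕ) (arms : ℕ → Set (Vec d)) (x : ℕ → Vec d) : ℝ :=
  ∑ t ∈ Finset.range T, (sSup ((fun y => inner ℝ y θ) '' arms t) - inner ℝ (x t) θ)

/-- The logarithmic factor
`ln (1 + T L² / (2 l_B λ) + (1 - (2 - B) / 2^(B+1)) ε / λ)`, where `B` is the number of blocks and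
`l_B` the length of the active one. -/
def logFactor (p : Params) (T : ℕ) (st : State d) : ℝ :=
  Real.log (1 + T * p.L ^ 2 / (2 * st.activeLen * p.lam)
    + (1 - (2 - (st.numBlocks : ℝ)) / 2 ^ (st.numBlocks + 1)) * (p.ε / p.lam))

/-- The regret bound, without its absolute constant. -/
def regretBound (p : Params) (T : ℕ) (st : State d) : ℝ :=
  p.L / √p.lam * √T * √(2 * st.activeLen * logFactor p T st)
    * (p.H * √(p.lam + p.ε)
      + p.R * √(d * Real.log (1 + p.ε / p.lam) + 2 * st.activeLen * logFactor p T st))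

/-- The real random variable `z` is `R`-subgaussian conditionally on the σ-algebra `m`. -/
def CondSubgaussian {Ω : Type*} {m₀ : MeasurableSpace Ω} (μ : Measure Ω) (m : MeasurableSpace Ω)
    (z : Ω → ℝ) (R : ℝ) : Prop :=
  ∀ s : ℝ, Integrable (fun ω => Real.exp (s * z ω)) μ ∧
    μ[fun ω => Real.exp (s * z ω) | m] ≤ᵐ[μ] fun _ => Real.exp (s ^ 2 * R ^ 2 / 2)

end

end DBS

/-! The regret analysis is that of optimism with a confidence ellipsoid; what has to be controlled
is the error of the sketch. One update of a block subtracts `σ V Vᵀ` from the Gram matrix and adds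
`σ` to the counter. Hence, with `X = ∑ xₛ xₛᵀ` and `α` the sum of the counters, `gram ≤ X ≤ gram + α
I` in the Loewner order, and `E = Â - X` satisfies `λ I ≤ E ≤ (λ + α) I`. This and the bounds on
lengths and counters form `State.Inv`, which `State.Inv.step` propagates.

Confidence: with `S = ∑ zₛ xₛ`, one has `θ̂ - θ = Â⁻¹ S - Â⁻¹ E θ`. The bias is at most `H √(λ + α)`
since `E Â⁻¹ E ≤ E`. For the noise, `Â ≥ λ I + X` reduces the `Â⁻¹`-norm of `S` to the classical
self-normalized bound (`measure_exists_lt_quad_noiseSum`), and the determinant in that bound is at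
most `det Â`. The latter is estimated through the rank and trace of the Gram matrix
(`log_det_le_of_rank_le`). The outcome is `abs_inner_hatTheta_sub_le`.

Potential: `log det Â - d log (λ + α)` gains at least `log (1 + ‖xₜ‖²)` (norm of `Â⁻¹`) per round,
up to the cost of shrinking. Shrinking by `σ` raises the regularization in at least `d - rank`
directions of the kernel (`log_det_add_compl_ge`), so it costs only `rank ≤ 2 l_B` times the
increment of `log (λ + α)`. The cost telescopes to `2 l_B log (1 + α / λ)`, with no factor `d`
(`IsRun.sum_log_le`).

Sizes: a block shrinks only while its size is at most `ε l₀`, so its counter is at most `ε l₀ / lᵢ`;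
lengths double, hence `α ≤ 2 ε`, and the lengths of all blocks add up to less than `2 l_B`. At the
block limit `d < 4 l_B`, so exact storage costs only a constant factor. The rest is comparison of
logarithms by Bernoulli's inequality. -/

namespace DBS

/-! ### Loewner order, determinants and rank -/

section LinearAlgebra

lemma posDef_smul_one_add {n : Type*} [DecidableEq n] {c : ℝ} (hc : 0 < c)
    {G : Matrix n n ℝ} (hG : G.PosSemidef) :
    (c • (1 : Matrix n n ℝ) + G).PosDef :=
  (Matrix.PosDef.one.smul hc).add_posSemidef hG

variable {n : Type*} [Fintype n]

lemma dotProduct_mulVec_comm {A : Matrix n n ℝ} (hA : A.IsHermitian) (x y : n → ℝ) :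
    x ⬝ᵥ (A *ᵥ y) = y ⬝ᵥ (A *ᵥ x) := by
  have h : Aᵀ = A := (Matrix.conjTranspose_eq_transpose_of_trivial A).symm.trans hA
  rw [Matrix.dotProduct_mulVec, ← Matrix.mulVec_transpose, h, dotProduct_comm]

lemma quad_nonneg {A : Matrix n n ℝ} (hA : A.PosSemidef) (x : n → ℝ) : 0 ≤ x ⬝ᵥ (A *ᵥ x) := by
  simpa using hA.dotProduct_mulVec_nonneg x

lemma quad_sub {A : Matrix n n ℝ} (hA : A.IsHermitian) (x y : n → ℝ) :
    (x - y) ⬝ᵥ (A *ᵥ (x - y)) = x ⬝ᵥ (A *ᵥ x) - 2 * (x ⬝ᵥ (A *ᵥ y)) + y ⬝ᵥ (A *ᵥ y) := by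
  simp only [Matrix.mulVec_sub, dotProduct_sub, sub_dotProduct, dotProduct_mulVec_comm hA y x]
  ring

/-- Cauchy-Schwarz inequality for a positive semidefinite matrix. -/
lemma sq_dotProduct_mulVec_le {A : Matrix n n ℝ} (hA : A.PosSemidef) (x y : n → ℝ) :
    (x ⬝ᵥ (A *ᵥ y)) ^ 2 ≤ (x ⬝ᵥ (A *ᵥ x)) * (y ⬝ᵥ (A *ᵥ y)) := by
  classical
  have h := LinearMap.BilinForm.apply_mul_apply_le_of_forall_zero_le (Matrix.toBilin' A)
    (fun x => by simpa [Matrix.toBilin'_apply'] using quad_nonneg hA x) x y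
  simp only [Matrix.toBilin'_apply'] at h
  rwa [dotProduct_mulVec_comm hA.1 y x, ← sq] at h

lemma abs_dotProduct_mulVec_le {A : Matrix n n ℝ} (hA : A.PosSemidef) (x y : n → ℝ) :
    |x ⬝ᵥ (A *ᵥ y)| ≤ √(x ⬝ᵥ (A *ᵥ x)) * √(y ⬝ᵥ (A *ᵥ y)) := by
  rw [← Real.sqrt_mul (quad_nonneg hA x)]
  exact Real.abs_le_sqrt (sq_dotProduct_mulVec_le hA x y)

lemma quad_le_quad {A B : Matrix n n ℝ} (h : (B - A).PosSemidef) (x : n → ℝ) :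
    x ⬝ᵥ (A *ᵥ x) ≤ x ⬝ᵥ (B *ᵥ x) := by
  have := quad_nonneg h x
  rw [Matrix.sub_mulVec, dotProduct_sub] at this
  linarith

lemma posSemidef_vecMulVec (x : n → ℝ) : (Matrix.vecMulVec x x).PosSemidef := by
  simpa using Matrix.posSemidef_vecMulVec_self_star x

variable [DecidableEq n]

lemma posDef_mulVec_inv_mulVec {A : Matrix n n ℝ} (hA : A.PosDef) (x : n → ℝ) :
    A *ᵥ (A⁻¹ *ᵥ x) = x := by
  rw [Matrix.mulVec_mulVec, Matrix.mul_nonsing_inv _ ((Matrix.isUnit_iff_isUnit_det A).1 hA.isUnit),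
    Matrix.one_mulVec]

lemma posDef_inv_mulVec_mulVec {A : Matrix n n ℝ} (hA : A.PosDef) (x : n → ℝ) :
    A⁻¹ *ᵥ (A *ᵥ x) = x := by
  rw [Matrix.mulVec_mulVec, Matrix.nonsing_inv_mul _ ((Matrix.isUnit_iff_isUnit_det A).1 hA.isUnit),
    Matrix.one_mulVec]

/-- One half of the variational formula `xᵀ A⁻¹ x = max_y (2 yᵀ x - yᵀ A y)`, by completing the
square at `y = A⁻¹ x`. It yields antitonicity of the inverse without square roots of matrices. -/
lemma two_mul_dotProduct_sub_quad_le {A : Matrix n n ℝ} (hA : A.PosDef) (x y : n → ℝ) :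
    2 * (y ⬝ᵥ x) - y ⬝ᵥ (A *ᵥ y) ≤ x ⬝ᵥ (A⁻¹ *ᵥ x) := by
  have h := quad_nonneg hA.posSemidef (y - A⁻¹ *ᵥ x)
  rw [quad_sub hA.1, posDef_mulVec_inv_mulVec hA, dotProduct_comm (A⁻¹ *ᵥ x) x] at h
  linarith

/-- The inverse is antitone in the Loewner order. -/
lemma quad_inv_le_quad_inv {A B : Matrix n n ℝ} (hA : A.PosDef) (h : (B - A).PosSemidef)
    (x : n → ℝ) : x ⬝ᵥ (B⁻¹ *ᵥ x) ≤ x ⬝ᵥ (A⁻¹ *ᵥ x) := by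
  have hB : B.PosDef := by simpa using hA.add_posSemidef h
  -- At `y = B⁻¹ x` the variational expression for `B` is attained, and replacing `B` by `A ≤ B`
  -- only increases it.
  have h1 := two_mul_dotProduct_sub_quad_le hA x (B⁻¹ *ᵥ x)
  have h2 := quad_le_quad h (B⁻¹ *ᵥ x)
  rw [posDef_mulVec_inv_mulVec hB, dotProduct_comm (B⁻¹ *ᵥ x) x] at h2
  rw [dotProduct_comm (B⁻¹ *ᵥ x) x] at h1
  linarith

/-- This is `E A⁻¹ E ≤ E` for `0 ≤ E ≤ A`, the bias estimate. Expand `(w - x)ᵀ E (w - x) ≥ 0` at `w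
= A⁻¹ E x` and bound `wᵀ E w` by `wᵀ A w = wᵀ E x`. -/
lemma quad_inv_mulVec_le {A E : Matrix n n ℝ} (hA : A.PosDef) (hE : E.PosSemidef)
    (h : (A - E).PosSemidef) (x : n → ℝ) :
    (E *ᵥ x) ⬝ᵥ (A⁻¹ *ᵥ (E *ᵥ x)) ≤ x ⬝ᵥ (E *ᵥ x) := by
  set w := A⁻¹ *ᵥ (E *ᵥ x) with hw
  have h1 := quad_nonneg hE (w - x)
  have h2 := quad_le_quad h w
  rw [quad_sub hE.1] at h1
  have h3 : w ⬝ᵥ (A *ᵥ w) = w ⬝ᵥ (E *ᵥ x) := by rw [hw, posDef_mulVec_inv_mulVec hA]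
  rw [dotProduct_comm]
  linarith

lemma det_add_vecMulVec {A : Matrix n n ℝ} (hA : A.PosDef) (x : n → ℝ) :
    (A + Matrix.vecMulVec x x).det = A.det * (1 + x ⬝ᵥ (A⁻¹ *ᵥ x)) := by
  rw [Matrix.vecMulVec_eq Unit, Matrix.det_add_replicateCol_mul_replicateRow
    ((Matrix.isUnit_iff_isUnit_det A).1 hA.isUnit)]
  congr 1
  rw [Matrix.det_unique, Matrix.mul_assoc, ← Matrix.replicateCol_mulVec]
  simp [Matrix.add_apply, Matrix.mul_apply, dotProduct]

/-- `B - A` is a sum of rank-one terms, and each of them multiplies the determinant by `1 + vᵀ M⁻¹ v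
≥ 1`. -/
lemma det_le_det {A B : Matrix n n ℝ} (hA : A.PosDef) (h : (B - A).PosSemidef) :
    A.det ≤ B.det := by
  obtain ⟨m, v, hv⟩ := Matrix.posSemidef_iff_eq_sum_vecMulVec.1 h
  have key : ∀ s : Finset (Fin m), A.det ≤ (A + ∑ i ∈ s, Matrix.vecMulVec (v i) (v i)).det := by
    intro s
    induction s using Finset.induction_on with
    | empty => simp
    | insert a s ha ih =>
      have hs : (A + ∑ i ∈ s, Matrix.vecMulVec (v i) (v i)).PosDef :=
        hA.add_posSemidef (Matrix.posSemidef_sum s fun i _ => posSemidef_vecMulVec _)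
      rw [Finset.sum_insert ha, add_comm (Matrix.vecMulVec _ _), ← add_assoc, det_add_vecMulVec hs]
      have := quad_nonneg hs.inv.posSemidef (v a)
      nlinarith [hs.det_pos]
  have h2 := key Finset.univ
  have h3 : B = A + ∑ i, Matrix.vecMulVec (v i) (v i) := by
    have : B - A = ∑ i, Matrix.vecMulVec (v i) (v i) := by simpa using hv
    rw [← this]; abel
  rwa [h3]

/-- Rank-one update of the weighted norm of a vector. -/
lemma quad_inv_rankOne {A : Matrix n n ℝ} (hA : A.PosDef) (x s : n → ℝ) (z : ℝ) :
    (s + z • x) ⬝ᵥ ((A + Matrix.vecMulVec x x)⁻¹ *ᵥ (s + z • x)) =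
      s ⬝ᵥ (A⁻¹ *ᵥ s) + (2 * z * (x ⬝ᵥ (A⁻¹ *ᵥ s)) + z ^ 2 * (x ⬝ᵥ (A⁻¹ *ᵥ x))
        - (x ⬝ᵥ (A⁻¹ *ᵥ s)) ^ 2) / (1 + x ⬝ᵥ (A⁻¹ *ᵥ x)) := by
  have hA' : (A + Matrix.vecMulVec x x).PosDef := hA.add_posSemidef (posSemidef_vecMulVec x)
  have hu := quad_nonneg hA.inv.posSemidef x
  have hsx := dotProduct_mulVec_comm hA.inv.1 s x
  set u := x ⬝ᵥ (A⁻¹ *ᵥ x) with hu'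
  set v := x ⬝ᵥ (A⁻¹ *ᵥ s) with hv'
  set c := (z - v) / (1 + u) with hc
  have h1 : (A + Matrix.vecMulVec x x)⁻¹ *ᵥ (s + z • x) = A⁻¹ *ᵥ s + c • (A⁻¹ *ᵥ x) := by
    have : (A + Matrix.vecMulVec x x) *ᵥ (A⁻¹ *ᵥ s + c • (A⁻¹ *ᵥ x)) = s + z • x := by
      rw [Matrix.add_mulVec, Matrix.mulVec_add, Matrix.mulVec_smul, posDef_mulVec_inv_mulVec hA,
        posDef_mulVec_inv_mulVec hA, Matrix.vecMulVec_mulVec, dotProduct_add, dotProduct_smul,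
        ← hu', ← hv']
      have hz : z = c + (v + c * u) := by rw [hc]; field_simp; ring
      ext i
      simp only [Pi.add_apply, Pi.smul_apply, smul_eq_mul, MulOpposite.smul_eq_mul_unop,
        MulOpposite.unop_op]
      linear_combination (-x i) * hz
    rw [← this, posDef_inv_mulVec_mulVec hA']
  rw [h1]
  simp only [dotProduct_add, add_dotProduct, dotProduct_smul, smul_dotProduct, smul_eq_mul]
  rw [hsx, ← hu', hc]
  field_simp
  ring

lemma exists_orthogonal_diagonal {K : Matrix n n ℝ} (hK : K.PosSemidef) :
    ∃ (W : Matrix n n ℝ) (k : n → ℝ), Wᵀ * W = 1 ∧ W * Wᵀ = 1 ∧ (∀ i, 0 ≤ k i) ∧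
      K = W * Matrix.diagonal k * Wᵀ ∧ K.rank = Fintype.card {i // k i ≠ 0} ∧
      K.trace = ∑ i, k i := by
  refine ⟨hK.1.eigenvectorUnitary, hK.1.eigenvalues, ?_, ?_, hK.eigenvalues_nonneg, ?_,
    hK.1.rank_eq_card_non_zero_eigs, ?_⟩
  · simpa [Matrix.star_eq_conjTranspose] using Unitary.coe_star_mul_self hK.1.eigenvectorUnitary
  · simpa [Matrix.star_eq_conjTranspose] using Unitary.coe_mul_star_self hK.1.eigenvectorUnitary
  · have := hK.1.spectral_theorem
    simpa [Unitary.conjStarAlgAut_apply, Matrix.star_eq_conjTranspose, Function.comp_def] using this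
  · simpa using hK.1.trace_eq_sum_eigenvalues

lemma det_orthogonal_conj {W : Matrix n n ℝ} (hW : Wᵀ * W = 1) (k : n → ℝ) :
    (W * Matrix.diagonal k * Wᵀ).det = ∏ i, k i := by
  rw [Matrix.det_mul_comm, ← Matrix.mul_assoc, hW, Matrix.one_mul, Matrix.det_diagonal]

lemma smul_one_add_conj_diagonal {W : Matrix n n ℝ} (hW : W * Wᵀ = 1) (c : ℝ) (k : n → ℝ) :
    c • (1 : Matrix n n ℝ) + W * Matrix.diagonal k * Wᵀ
      = W * Matrix.diagonal (fun i => c + k i) * Wᵀ := by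
  have : Matrix.diagonal (fun i => c + k i) = c • (1 : Matrix n n ℝ) + Matrix.diagonal k := by
    rw [← Matrix.diagonal_one, ← Matrix.diagonal_smul, Matrix.diagonal_add]; simp
  rw [this, Matrix.mul_add, Matrix.add_mul, Matrix.mul_smul, Matrix.mul_one, Matrix.smul_mul, hW]

/-- The tangent of the concave function `log (1 + ·)` at `m`. Summed with `m` an average it plays
the role of Jensen's inequality; at `a = 0` it gives `m / (1 + m) ≤ log (1 + m)`. -/
lemma log_one_add_sub_le {a m : ℝ} (ha : 0 ≤ a) (hm : 0 ≤ m) :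
    Real.log (1 + a) ≤ Real.log (1 + m) + (a - m) / (1 + m) := by
  have h := Real.log_le_sub_one_of_pos (x := (1 + a) / (1 + m)) (by positivity)
  rw [Real.log_div (by positivity) (by positivity)] at h
  have : (1 + a) / (1 + m) - 1 = (a - m) / (1 + m) := by field_simp; ring
  linarith

/-- The log-determinant of a regularized matrix of rank at most `k`. -/
lemma log_det_le_of_rank_le {G : Matrix n n ℝ} (hG : G.PosSemidef) {c : ℝ} (hc : 0 < c) {k : ℕ}
    (hk : 0 < k) (hr : G.rank ≤ k) :
    Real.log (c • (1 : Matrix n n ℝ) + G).det ≤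
      Fintype.card n * Real.log c + k * Real.log (1 + G.trace / (k * c)) := by
  obtain ⟨W, g, hW, hW', hg, hGW, hrank, htr⟩ := exists_orthogonal_diagonal hG
  set m := G.trace / (k * c) with hm
  have hm0 : 0 ≤ m := div_nonneg hG.trace_nonneg (by positivity)
  have h1 : Real.log (c • (1 : Matrix n n ℝ) + G).det
      = Fintype.card n * Real.log c + ∑ i, Real.log (1 + g i / c) := by
    rw [hGW, smul_one_add_conj_diagonal hW', det_orthogonal_conj hW,
      Real.log_prod (fun i _ => by have := hg i; positivity)]
    have : ∀ i, Real.log (c + g i) = Real.log c + Real.log (1 + g i / c) := by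
      intro i
      have := hg i
      rw [← Real.log_mul (by positivity) (by positivity)]
      congr 1; field_simp
    simp [this, Finset.sum_add_distrib]
  rw [h1]
  have h2 : ∑ i, Real.log (1 + g i / c) = ∑ i with g i ≠ 0, Real.log (1 + g i / c) := by
    symm
    apply Finset.sum_subset (Finset.filter_subset _ _)
    intro i _ hi
    simp only [Finset.mem_filter, Finset.mem_univ, true_and, not_not] at hi
    simp [hi]
  have h3 : ∑ i with g i ≠ 0, g i = G.trace := by
    rw [htr]
    apply Finset.sum_subset (Finset.filter_subset _ _)
    intro i _ hi
    simpa using hi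
  have hcard : (Finset.univ.filter fun i => g i ≠ 0).card = G.rank := by
    rw [hrank, Fintype.card_subtype]
  -- The tangent point `m` averages over `k` eigenvalues although only `rank G ≤ k` are nonzero; the
  -- surplus `(k - rank G) m / (1 + m)` is absorbed by `h6`.
  have h4 : ∑ i with g i ≠ 0, Real.log (1 + g i / c) ≤
      ∑ i with g i ≠ 0, (Real.log (1 + m) + (g i / c - m) / (1 + m)) :=
    Finset.sum_le_sum fun i _ => log_one_add_sub_le (div_nonneg (hg i) hc.le) hm0
  rw [Finset.sum_add_distrib, ← Finset.sum_div, Finset.sum_sub_distrib, ← Finset.sum_div, h3,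
    Finset.sum_const, Finset.sum_const, hcard, nsmul_eq_mul, nsmul_eq_mul] at h4
  have h5 : G.trace / c = k * m := by rw [hm]; field_simp
  have h6 : m / (1 + m) ≤ Real.log (1 + m) := by
    have h := log_one_add_sub_le le_rfl hm0
    simp only [add_zero, Real.log_one, zero_sub, neg_div] at h
    linarith
  have h7 : (G.rank : ℝ) ≤ k := by exact_mod_cast hr
  have h8 : (k * m - G.rank * m) / (1 + m) = (k - G.rank) * (m / (1 + m)) := by ring
  rw [h5, h8] at h4
  nlinarith [mul_le_mul_of_nonneg_left h6 (sub_nonneg.2 h7)]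

lemma posSemidef_one_sub_mul_transpose {l : Type*} [Fintype l] [DecidableEq l] {V : Matrix n l ℝ}
    (hV : Vᵀ * V = 1) : (1 - V * Vᵀ).PosSemidef := by
  have : 1 - V * Vᵀ = (1 - V * Vᵀ)ᴴ * (1 - V * Vᵀ) := by
    simp only [Matrix.conjTranspose_eq_transpose_of_trivial, Matrix.transpose_sub,
      Matrix.transpose_one, Matrix.transpose_mul, Matrix.transpose_transpose]
    have : V * Vᵀ * (V * Vᵀ) = V * Vᵀ := by
      rw [Matrix.mul_assoc, ← Matrix.mul_assoc Vᵀ, hV, Matrix.one_mul]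
    simp only [Matrix.mul_sub, Matrix.sub_mul, Matrix.mul_one, Matrix.one_mul, this]
    simp
  rw [this]
  exact Matrix.posSemidef_conjTranspose_mul_self _

/-- Adding `σ` in all directions orthogonal to the columns of `V`, which lie in the range of `K`,
increases the log-determinant of `c I + K` at least by `(n - rank K) log ((c + σ) / c)`. -/
lemma log_det_add_compl_ge {K : Matrix n n ℝ} (hK : K.PosSemidef) {c σ : ℝ} (hc : 0 < c)
    (hσ : 0 ≤ σ) {l : Type*} [Fintype l] [DecidableEq l] {V : Matrix n l ℝ} (hV : Vᵀ * V = 1)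
    (hKV : ∀ w, K *ᵥ w = 0 → Vᵀ *ᵥ w = 0) :
    Real.log (c • (1 : Matrix n n ℝ) + K).det
        + ((Fintype.card n : ℝ) - K.rank) * (Real.log (c + σ) - Real.log c)
      ≤ Real.log (c • (1 : Matrix n n ℝ) + K + σ • (1 - V * Vᵀ)).det := by
  obtain ⟨W, k, hW, hW', hk, hKW, hrank, -⟩ := exists_orthogonal_diagonal hK
  classical
  -- `Q` is the orthogonal projection onto the kernel of `K`. The columns of `V` are orthogonal to
  -- that kernel, so `Q ≤ 1 - V Vᵀ`, and `det (c I + K + σ Q)` is explicit because `Q` and `K` share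
  -- an eigenbasis.
  let e : n → ℝ := fun i => if k i = 0 then 1 else 0
  let Q : Matrix n n ℝ := W * Matrix.diagonal e * Wᵀ
  have hKQ : K * Q = 0 := by
    rw [hKW]
    simp only [Q]
    rw [Matrix.mul_assoc (W * Matrix.diagonal k), ← Matrix.mul_assoc Wᵀ, ← Matrix.mul_assoc Wᵀ, hW,
      Matrix.one_mul, ← Matrix.mul_assoc, Matrix.mul_assoc W, Matrix.diagonal_mul_diagonal]
    have : (fun i => k i * e i) = 0 := by ext i; by_cases h : k i = 0 <;> simp [e, h]
    rw [this]; simp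
  have hVQ : Vᵀ * Q = 0 := by
    ext i j
    have h := hKV (fun a => Q a j) (by
      ext a
      simpa [Matrix.mul_apply, Matrix.mulVec, dotProduct] using congrFun (congrFun hKQ a) j)
    simpa [Matrix.mul_apply, Matrix.mulVec, dotProduct] using congrFun h i
  have hQt : Qᵀ = Q := by
    simp [Q, Matrix.transpose_mul, Matrix.mul_assoc]
  have hQV : Q * V = 0 := by
    have := congrArg Matrix.transpose hVQ
    simpa [Matrix.transpose_mul, hQt] using this
  have hQQ : Q * Q = Q := by
    simp only [Q]
    rw [Matrix.mul_assoc (W * Matrix.diagonal e), ← Matrix.mul_assoc Wᵀ, ← Matrix.mul_assoc Wᵀ, hW,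
      Matrix.one_mul, ← Matrix.mul_assoc, Matrix.mul_assoc W, Matrix.diagonal_mul_diagonal]
    congr 3
    ext i; by_cases h : k i = 0 <;> simp [e, h]
  have hdiff : 1 - V * Vᵀ - Q = (1 - Q)ᴴ * (1 - V * Vᵀ) * (1 - Q) := by
    simp only [Matrix.conjTranspose_eq_transpose_of_trivial, Matrix.transpose_sub,
      Matrix.transpose_one, hQt]
    have e1 : Q * (V * Vᵀ) = 0 := by rw [← Matrix.mul_assoc, hQV, Matrix.zero_mul]
    have e2 : V * Vᵀ * Q = 0 := by rw [Matrix.mul_assoc, hVQ, Matrix.mul_zero]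
    simp only [Matrix.mul_sub, Matrix.sub_mul, Matrix.mul_one, Matrix.one_mul, e1, e2, hQQ,
      sub_zero]
    abel
  have hpsd : (1 - V * Vᵀ - Q).PosSemidef := by
    rw [hdiff]
    exact (posSemidef_one_sub_mul_transpose hV).conjTranspose_mul_mul_same _
  have hM : c • (1 : Matrix n n ℝ) + K + σ • Q
      = W * Matrix.diagonal (fun i => c + k i + σ * e i) * Wᵀ := by
    have : Matrix.diagonal (fun i => c + k i + σ * e i)
        = Matrix.diagonal (fun i => c + k i) + σ • Matrix.diagonal e := by
      rw [← Matrix.diagonal_smul, Matrix.diagonal_add]; rfl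
    rw [this, Matrix.mul_add, Matrix.add_mul, ← smul_one_add_conj_diagonal hW', Matrix.mul_smul,
      Matrix.smul_mul, ← hKW]
  have he : ∀ i, 0 ≤ e i := fun i => by by_cases h : k i = 0 <;> simp [e, h]
  have hQpsd : Q.PosSemidef := by
    have : Q = Qᴴ * Q := by
      rw [Matrix.conjTranspose_eq_transpose_of_trivial, hQt, hQQ]
    rw [this]
    exact Matrix.posSemidef_conjTranspose_mul_self _
  have hMpd : (c • (1 : Matrix n n ℝ) + K + σ • Q).PosDef :=
    (posDef_smul_one_add hc hK).add_posSemidef (hQpsd.smul hσ)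
  have hle := det_le_det hMpd (B := c • (1 : Matrix n n ℝ) + K + σ • (1 - V * Vᵀ)) (by
    have : c • (1 : Matrix n n ℝ) + K + σ • (1 - V * Vᵀ) - (c • (1 : Matrix n n ℝ) + K + σ • Q)
        = σ • (1 - V * Vᵀ - Q) := by rw [smul_sub σ _ Q]; abel
    rw [this]
    exact hpsd.smul hσ)
  refine le_trans (le_of_eq ?_) (Real.log_le_log hMpd.det_pos hle)
  rw [hM, det_orthogonal_conj hW, hKW, smul_one_add_conj_diagonal hW', det_orthogonal_conj hW,
    Real.log_prod (fun i _ => by have := hk i; positivity),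
    Real.log_prod (fun i _ => by have := hk i; have := he i; positivity), ← hKW]
  have h1 : ∀ i, Real.log (c + k i + σ * e i)
      = Real.log (c + k i) + e i * (Real.log (c + σ) - Real.log c) := by
    intro i; by_cases h : k i = 0 <;> simp [e, h]
  have h2 : ∑ i, e i = (Fintype.card n : ℝ) - K.rank := by
    have : ∀ i, e i = 1 - if k i ≠ 0 then 1 else 0 := by
      intro i; by_cases h : k i = 0 <;> simp [e, h]
    simp only [this, Finset.sum_sub_distrib, Finset.sum_boole]
    rw [hrank, Fintype.card_subtype]
    simp
  simp only [h1, Finset.sum_add_distrib, ← Finset.sum_mul, h2]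

end LinearAlgebra

/-! ### Self-normalized concentration by Gaussian mixtures -/

section SelfNormalized

open scoped ENNReal NNReal

variable {Ω : Type*} {m m₀ : MeasurableSpace Ω} {μ : Measure Ω} [IsProbabilityMeasure μ]

/-- Subgaussianity says that on `m` the measure with density `exp (g z - g² / 2)` is dominated by
`μ`. Comparing the two trimmed measures gives the bound for every nonnegative `m`-measurable `f`,
with no integrability assumption. -/
lemma lintegral_mul_exp_le (hm : m ≤ m₀) {z : Ω → ℝ} (hz : Measurable z)
    (hs : CondSubgaussian μ m z 1) (g : ℝ) {f : Ω → ℝ≥0∞} (hf : Measurable[m] f) :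
    ∫⁻ ω, f ω * ENNReal.ofReal (Real.exp (g * z ω - g ^ 2 / 2)) ∂μ ≤ ∫⁻ ω, f ω ∂μ := by
  set h : Ω → ℝ≥0∞ := fun ω => ENNReal.ofReal (Real.exp (g * z ω - g ^ 2 / 2)) with hh
  have hmeas : Measurable h := by fun_prop
  have hle : (μ.withDensity h).trim hm ≤ μ.trim hm := by
    refine Measure.le_iff.2 fun s hs' => ?_
    rw [trim_measurableSet_eq hm hs', trim_measurableSet_eq hm hs', withDensity_apply _ (hm s hs')]
    have hexp : Integrable (fun ω => Real.exp (g * z ω - g ^ 2 / 2)) μ := by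
      simp only [Real.exp_sub]
      exact (hs g).1.div_const _
    rw [← ofReal_integral_eq_lintegral_ofReal hexp.integrableOn
      (Filter.Eventually.of_forall fun ω => (Real.exp_pos _).le)]
    refine ENNReal.ofReal_le_of_le_toReal ?_
    simp only [Real.exp_sub]
    rw [integral_div, div_le_iff₀ (Real.exp_pos _), ← setIntegral_condExp hm (hs g).1 hs']
    calc ∫ ω in s, (μ[fun ω => Real.exp (g * z ω)|m]) ω ∂μ
        ≤ ∫ ω in s, Real.exp (g ^ 2 * 1 ^ 2 / 2) ∂μ :=
          setIntegral_mono_ae integrable_condExp.integrableOn (integrable_const _).integrableOn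
            (hs g).2
      _ = (μ s).toReal * Real.exp (g ^ 2 / 2) := by simp [Measure.real]
  calc ∫⁻ ω, f ω * h ω ∂μ = ∫⁻ ω, f ω ∂(μ.withDensity h) := by
        rw [lintegral_withDensity_eq_lintegral_mul _ hmeas (hf.mono hm le_rfl)]
        simp only [Pi.mul_apply, mul_comm]
    _ = ∫⁻ ω, f ω ∂((μ.withDensity h).trim hm) := (lintegral_trim hm hf).symm
    _ ≤ ∫⁻ ω, f ω ∂(μ.trim hm) := lintegral_mono' hle le_rfl
    _ = ∫⁻ ω, f ω ∂μ := lintegral_trim hm hf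

/-- Completing the square in `g`: up to a constant, the tilted Gaussian density is again Gaussian,
with variance `u / (1 + u)`. -/
lemma gaussianPDFReal_mul_exp {u : ℝ} (hu : 0 < u) (v z g : ℝ) :
    gaussianPDFReal v u.toNNReal g * Real.exp (g * z - g ^ 2 / 2) =
      Real.exp ((2 * z * v + z ^ 2 * u - v ^ 2) / (2 * (1 + u))) / √(1 + u) *
        gaussianPDFReal ((v + u * z) / (1 + u)) (u / (1 + u)).toNNReal g := by
  have h1 : (0 : ℝ) < 1 + u := by positivity
  rw [gaussianPDFReal_def, gaussianPDFReal_def]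
  simp only [Real.coe_toNNReal _ hu.le, Real.coe_toNNReal _ (div_pos hu h1).le]
  have h2 : √(2 * Real.pi * (u / (1 + u))) = √(2 * Real.pi * u) / √(1 + u) := by
    rw [← Real.sqrt_div (by positivity)]; congr 1; ring
  rw [h2, mul_assoc, ← Real.exp_add]
  have h3 : -(g - v) ^ 2 / (2 * u) + (g * z - g ^ 2 / 2) =
      (2 * z * v + z ^ 2 * u - v ^ 2) / (2 * (1 + u))
        + -(g - (v + u * z) / (1 + u)) ^ 2 / (2 * (u / (1 + u))) := by
    field_simp
    ring
  rw [h3, Real.exp_add]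
  have : (0 : ℝ) < √(1 + u) := Real.sqrt_pos.2 h1
  field_simp

lemma lintegral_gaussianPDF_mul_exp {u : ℝ} (hu : 0 < u) (v z : ℝ) :
    ∫⁻ g, gaussianPDF v u.toNNReal g * ENNReal.ofReal (Real.exp (g * z - g ^ 2 / 2)) =
      ENNReal.ofReal (Real.exp ((2 * z * v + z ^ 2 * u - v ^ 2) / (2 * (1 + u))) / √(1 + u)) := by
  have h1 : (0 : ℝ) < u / (1 + u) := by positivity
  have h : ∀ g, gaussianPDF v u.toNNReal g * ENNReal.ofReal (Real.exp (g * z - g ^ 2 / 2)) =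
      ENNReal.ofReal (Real.exp ((2 * z * v + z ^ 2 * u - v ^ 2) / (2 * (1 + u))) / √(1 + u)) *
        gaussianPDF ((v + u * z) / (1 + u)) (u / (1 + u)).toNNReal g := by
    intro g
    simp only [gaussianPDF_def]
    rw [← ENNReal.ofReal_mul (gaussianPDFReal_nonneg _ _ _), gaussianPDFReal_mul_exp hu,
      ENNReal.ofReal_mul (by positivity)]
  simp only [h]
  rw [lintegral_const_mul _ (measurable_gaussianPDF _ _), lintegral_gaussianPDF_eq_one _ (by
    simpa using h1), mul_one]

/-- Integrating out one conditionally subgaussian noise variable by a Gaussian mixture. -/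
lemma lintegral_mul_mixture_le (hm : m ≤ m₀) {z : Ω → ℝ}
    (hz : Measurable z) (hs : CondSubgaussian μ m z 1) {u v : Ω → ℝ} (hu : Measurable[m] u)
    (hv : Measurable[m] v) (hu0 : ∀ ω, 0 ≤ u ω) (huv : ∀ ω, u ω = 0 → v ω = 0)
    {f : Ω → ℝ≥0∞} (hf : Measurable[m] f) :
    ∫⁻ ω, f ω * ENNReal.ofReal (Real.exp ((2 * z ω * v ω + z ω ^ 2 * u ω - v ω ^ 2)
        / (2 * (1 + u ω))) / √(1 + u ω)) ∂μ ≤ ∫⁻ ω, f ω ∂μ := by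
  -- For `u = 0` the Gaussian has no density and `gaussianPDF` vanishes, so this set is treated
  -- apart; there `v = 0` and the factor is `1`.
  have hset : MeasurableSet[m] {ω | u ω = 0} := hu (measurableSet_singleton 0)
  rw [← lintegral_add_compl (fun ω => f ω * _) (hm _ hset),
    ← lintegral_add_compl f (hm _ hset)]
  refine add_le_add (le_of_eq ?_) ?_
  · refine setLIntegral_congr_fun (hm _ hset) fun ω hω => ?_
    have h1 : u ω = 0 := hω
    simp [h1, huv ω h1]
  set s : Set Ω := {ω | u ω = 0}ᶜ with hsdef
  have hsm : MeasurableSet[m] s := hset.compl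
  have hpdf : Measurable (fun q : Ω × ℝ => gaussianPDF (v q.1) (u q.1).toNNReal q.2) :=
    measurable_uncurry_gaussianPDF.comp (Measurable.prodMk ((hv.mono hm le_rfl).comp measurable_fst)
      (Measurable.prodMk ((hu.mono hm le_rfl).comp measurable_fst).real_toNNReal measurable_snd))
  have hpdf_fix : ∀ g, Measurable[m] fun ω => gaussianPDF (v ω) (u ω).toNNReal g := fun g =>
    measurable_uncurry_gaussianPDF.comp
      (Measurable.prodMk hv (Measurable.prodMk hu.real_toNNReal measurable_const))
  have hF : Measurable[m] (s.indicator f) := hf.indicator hsm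
  have hF' : Measurable (s.indicator f) := hF.mono hm le_rfl
  have hpos : ∀ ω ∈ s, 0 < u ω := fun ω hω => lt_of_le_of_ne (hu0 ω) (Ne.symm hω)
  calc ∫⁻ ω in s, f ω * ENNReal.ofReal (Real.exp ((2 * z ω * v ω + z ω ^ 2 * u ω - v ω ^ 2)
          / (2 * (1 + u ω))) / √(1 + u ω)) ∂μ
      = ∫⁻ ω, (∫⁻ g, s.indicator f ω * (gaussianPDF (v ω) (u ω).toNNReal g
          * ENNReal.ofReal (Real.exp (g * z ω - g ^ 2 / 2)))) ∂μ := by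
        rw [← lintegral_indicator (hm _ hsm)]
        refine lintegral_congr fun ω => ?_
        rw [lintegral_const_mul _ (by fun_prop)]
        by_cases hω : ω ∈ s
        · rw [Set.indicator_of_mem hω, Set.indicator_of_mem hω,
            lintegral_gaussianPDF_mul_exp (hpos ω hω)]
        · simp [Set.indicator_of_notMem hω]
    -- After Tonelli, `g` is fixed and the Gaussian weight is `m`-measurable, so it can be merged
    -- with `f` before the noise is integrated out.
    _ = ∫⁻ g, ∫⁻ ω, s.indicator f ω * (gaussianPDF (v ω) (u ω).toNNReal g
          * ENNReal.ofReal (Real.exp (g * z ω - g ^ 2 / 2))) ∂μ := by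
        refine lintegral_lintegral_swap (Measurable.aemeasurable ?_)
        refine (hF'.comp measurable_fst).mul (hpdf.mul ?_)
        fun_prop
    _ ≤ ∫⁻ g, ∫⁻ ω, s.indicator f ω * gaussianPDF (v ω) (u ω).toNNReal g ∂μ := by
        refine lintegral_mono fun g => ?_
        simp only [← mul_assoc]
        exact lintegral_mul_exp_le hm hz hs g (hF.mul (hpdf_fix g))
    _ = ∫⁻ ω, (∫⁻ g, s.indicator f ω * gaussianPDF (v ω) (u ω).toNNReal g) ∂μ :=
        (lintegral_lintegral_swap ((hF'.comp measurable_fst).mul hpdf).aemeasurable).symm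
    _ = ∫⁻ ω in s, f ω ∂μ := by
        rw [← lintegral_indicator (hm _ hsm)]
        refine lintegral_congr fun ω => ?_
        rw [lintegral_const_mul _ (measurable_gaussianPDF _ _)]
        by_cases hω : ω ∈ s
        · rw [lintegral_gaussianPDF_eq_one _ (by simpa using hpos ω hω), mul_one]
        · simp [Set.indicator_of_notMem hω]

/-- Maximal inequality for a nonnegative supermartingale. -/
lemma measure_exists_le_of_supermartingale (ℱ : Filtration ℕ m₀) {W : ℕ → Ω → ℝ≥0∞} {N : ℕ}
    (hW : ∀ t ≤ N, Measurable[ℱ t] (W t)) (hW0 : ∀ ω, W 0 ω ≤ 1)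
    (hstep : ∀ t < N, ∀ s, MeasurableSet[ℱ t] s → ∫⁻ ω in s, W (t + 1) ω ∂μ ≤ ∫⁻ ω in s, W t ω ∂μ)
    (c : ℝ≥0∞) :
    c * μ {ω | ∃ t ≤ N, c ≤ W t ω} ≤ 1 := by
  let E : ℕ → Set Ω := fun n => {ω | ∃ t ≤ n, c ≤ W t ω}
  have hE : ∀ n ≤ N, MeasurableSet[ℱ n] (E n) := by
    intro n hn
    have : E n = ⋃ t ∈ Finset.range (n + 1), {ω | c ≤ W t ω} := by
      ext ω; simp [E]
    rw [this]
    refine Finset.measurableSet_biUnion _ fun t ht => ?_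
    have htn : t ≤ n := by simpa [Nat.lt_succ_iff] using ht
    exact ℱ.mono htn _ ((hW t (htn.trans hn)) measurableSet_Ici)
  -- Freezing the process once it reaches `c`: the mass already stopped, counted with weight `c`,
  -- plus the remaining integral never exceeds `1`.
  have key : ∀ n ≤ N, c * μ (E n) + ∫⁻ ω in (E n)ᶜ, W n ω ∂μ ≤ 1 := by
    intro n
    induction n with
    | zero =>
      intro _
      have h0 : c * μ (E 0) ≤ ∫⁻ ω in E 0, W 0 ω ∂μ := by
        rw [← setLIntegral_const]
        exact setLIntegral_mono' (ℱ.le 0 _ (hE 0 (Nat.zero_le _))) fun ω hω => by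
          obtain ⟨t, ht, h⟩ := hω
          obtain rfl : t = 0 := by omega
          exact h
      calc c * μ (E 0) + ∫⁻ ω in (E 0)ᶜ, W 0 ω ∂μ
          ≤ ∫⁻ ω in E 0, W 0 ω ∂μ + ∫⁻ ω in (E 0)ᶜ, W 0 ω ∂μ := by gcongr
        _ = ∫⁻ ω, W 0 ω ∂μ := lintegral_add_compl _ (ℱ.le 0 _ (hE 0 (Nat.zero_le _)))
        _ ≤ ∫⁻ _, 1 ∂μ := lintegral_mono hW0
        _ = 1 := by simp
    | succ n ih =>
      intro hn
      have hEn := hE n (by omega)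
      have hEn1 := ℱ.le _ _ (hE (n + 1) hn)
      have hsub : E n ⊆ E (n + 1) := fun ω ⟨t, ht, h⟩ => ⟨t, by omega, h⟩
      have hnew : c * μ (E (n + 1) \ E n) ≤ ∫⁻ ω in E (n + 1) \ E n, W (n + 1) ω ∂μ := by
        rw [← setLIntegral_const]
        refine setLIntegral_mono' (hEn1.diff (ℱ.le _ _ hEn)) fun ω hω => ?_
        obtain ⟨⟨t, ht, h⟩, hnot⟩ := hω
        rcases Nat.lt_or_ge n t with h' | h'
        · obtain rfl : t = n + 1 := by omega
          exact h
        · exact absurd ⟨t, h', h⟩ hnot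
      have hsplit : ∫⁻ ω in (E n)ᶜ, W (n + 1) ω ∂μ
          = ∫⁻ ω in E (n + 1) \ E n, W (n + 1) ω ∂μ + ∫⁻ ω in (E (n + 1))ᶜ, W (n + 1) ω ∂μ := by
        rw [← lintegral_union hEn1.compl]
        · congr 2
          ext ω
          simp only [Set.mem_compl_iff, Set.mem_union, Set.mem_sdiff]
          constructor
          · intro h; tauto
          · rintro (h | h)
            · exact h.2
            · exact fun h' => h (hsub h')
        · exact Set.disjoint_left.2 fun ω h h' => h' h.1
      have hμ : μ (E (n + 1)) = μ (E n) + μ (E (n + 1) \ E n) := by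
        rw [measure_sdiff hsub (ℱ.le _ _ hEn).nullMeasurableSet (measure_ne_top _ _),
          add_tsub_cancel_of_le (measure_mono hsub)]
      calc c * μ (E (n + 1)) + ∫⁻ ω in (E (n + 1))ᶜ, W (n + 1) ω ∂μ
          = c * μ (E n) + (c * μ (E (n + 1) \ E n)
            + ∫⁻ ω in (E (n + 1))ᶜ, W (n + 1) ω ∂μ) := by rw [hμ, mul_add, add_assoc]
        _ ≤ c * μ (E n) + ∫⁻ ω in (E n)ᶜ, W (n + 1) ω ∂μ := by rw [hsplit]; gcongr
        _ ≤ c * μ (E n) + ∫⁻ ω in (E n)ᶜ, W n ω ∂μ := by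
          exact add_le_add le_rfl (hstep n (by omega) _ hEn.compl)
        _ ≤ 1 := ih (by omega)
  exact le_trans le_self_add (key N le_rfl)

/-- The regularized covariance matrix `λ I + ∑_{s < t} x_s x_sᵀ`. -/
noncomputable def design {d : ℕ} (lam : ℝ) (x : ℕ → Vec d) (t : ℕ) : Matrix (Fin d) (Fin d) ℝ :=
  lam • 1 + ∑ s ∈ Finset.range t, Matrix.vecMulVec (x s).ofLp (x s).ofLp

/-- The noise vector `∑_{s < t} z_s x_s`. -/
def noiseSum {d : ℕ} (x : ℕ → Vec d) (z : ℕ → ℝ) (t : ℕ) : Fin d → ℝ :=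
  ∑ s ∈ Finset.range t, z s • (x s).ofLp

lemma posDef_design {d : ℕ} {lam : ℝ} (hlam : 0 < lam) (x : ℕ → Vec d) (t : ℕ) :
    (design lam x t).PosDef :=
  posDef_smul_one_add hlam (Matrix.posSemidef_sum _ fun _ _ => posSemidef_vecMulVec _)

lemma design_succ {d : ℕ} (lam : ℝ) (x : ℕ → Vec d) (t : ℕ) :
    design lam x (t + 1) = design lam x t + Matrix.vecMulVec (x t).ofLp (x t).ofLp := by
  simp [design, Finset.sum_range_succ, add_assoc]

lemma noiseSum_succ {d : ℕ} (x : ℕ → Vec d) (z : ℕ → ℝ) (t : ℕ) :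
    noiseSum x z (t + 1) = noiseSum x z t + z t • (x t).ofLp := by
  simp [noiseSum, Finset.sum_range_succ]

/-- The mixture `det (A_t / λ)^(-1/2) exp (‖S_t‖² / 2)`. -/
noncomputable def mixture {d : ℕ} (lam : ℝ) (x : ℕ → Vec d) (z : ℕ → ℝ) (t : ℕ) : ℝ :=
  Real.exp (noiseSum x z t ⬝ᵥ ((design lam x t)⁻¹ *ᵥ noiseSum x z t) / 2)
    / √((design lam x t).det / lam ^ d)

lemma mixture_zero {d : ℕ} {lam : ℝ} (hlam : 0 < lam) (x : ℕ → Vec d) (z : ℕ → ℝ) :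
    mixture lam x z 0 = 1 := by
  have : lam ^ d ≠ 0 := (pow_pos hlam d).ne'
  simp [mixture, noiseSum, design, this]

/-- The ratio of consecutive mixtures is the Gaussian integral of `exp (g z - g² / 2)` for mean `v =
xᵀ A⁻¹ S` and variance `u = xᵀ A⁻¹ x`, both known before `z` is revealed. The mixture over `ℝ^d` is
thus integrated one dimension at a time. -/
lemma mixture_succ {d : ℕ} {lam : ℝ} (hlam : 0 < lam) (x : ℕ → Vec d) (z : ℕ → ℝ) (t : ℕ) :
    mixture lam x z (t + 1) = mixture lam x z t *
      (Real.exp ((2 * z t * ((x t).ofLp ⬝ᵥ ((design lam x t)⁻¹ *ᵥ noiseSum x z t))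
        + z t ^ 2 * ((x t).ofLp ⬝ᵥ ((design lam x t)⁻¹ *ᵥ (x t).ofLp))
        - ((x t).ofLp ⬝ᵥ ((design lam x t)⁻¹ *ᵥ noiseSum x z t)) ^ 2)
        / (2 * (1 + (x t).ofLp ⬝ᵥ ((design lam x t)⁻¹ *ᵥ (x t).ofLp))))
      / √(1 + (x t).ofLp ⬝ᵥ ((design lam x t)⁻¹ *ᵥ (x t).ofLp))) := by
  have hA := posDef_design hlam x t
  have hdet := hA.det_pos
  have hu := quad_nonneg hA.inv.posSemidef (x t).ofLp
  have hl : (0 : ℝ) < lam ^ d := pow_pos hlam d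
  rw [mixture, mixture, noiseSum_succ, design_succ, quad_inv_rankOne hA, det_add_vecMulVec hA]
  rw [div_mul_div_comm, ← Real.exp_add, ← Real.sqrt_mul (by positivity)]
  congr 2
  · field_simp
  · ring

lemma stronglyMeasurable_quad_inv {d : ℕ} {A : Ω → Matrix (Fin d) (Fin d) ℝ}
    {a b : Ω → Fin d → ℝ} (hA : StronglyMeasurable[m] A) (ha : StronglyMeasurable[m] a)
    (hb : StronglyMeasurable[m] b) :
    StronglyMeasurable[m] fun ω => a ω ⬝ᵥ ((A ω)⁻¹ *ᵥ b ω) := by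
  -- The inverse is not continuous, but the adjugate is, and the inverse of the determinant is
  -- measurable.
  have h : ∀ ω, a ω ⬝ᵥ ((A ω)⁻¹ *ᵥ b ω) = (A ω).det⁻¹ * (a ω ⬝ᵥ ((A ω).adjugate *ᵥ b ω)) := by
    intro ω
    rw [Matrix.inv_def, Ring.inverse_eq_inv', Matrix.smul_mulVec, dotProduct_smul, smul_eq_mul]
  simp only [h]
  have hdet : StronglyMeasurable[m] fun ω => (A ω).det :=
    (continuous_id.matrix_det).comp_stronglyMeasurable hA
  refine hdet.measurable.inv.stronglyMeasurable.mul ?_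
  have hc : Continuous fun q : (Fin d → ℝ) × Matrix (Fin d) (Fin d) ℝ × (Fin d → ℝ) =>
      q.1 ⬝ᵥ (q.2.1.adjugate *ᵥ q.2.2) := by
    refine Continuous.dotProduct continuous_fst (Continuous.matrix_mulVec ?_ ?_)
    · exact (continuous_fst.comp continuous_snd).matrix_adjugate
    · exact continuous_snd.comp continuous_snd
  exact hc.comp_stronglyMeasurable (ha.prodMk (hA.prodMk hb))

variable {ℱ : Filtration ℕ m₀} {d T : ℕ} {x : ℕ → Ω → Vec d} {z : ℕ → Ω → ℝ}

lemma stronglyMeasurable_design (hx : ∀ t < T, StronglyMeasurable[ℱ t] (x t)) (lam : ℝ) {t : ℕ}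
    (ht : t ≤ T) : StronglyMeasurable[ℱ t] fun ω => design lam (fun s => x s ω) t := by
  unfold design
  refine stronglyMeasurable_const.add (Finset.stronglyMeasurable_fun_sum _ fun s hs => ?_)
  have hst : s < t := Finset.mem_range.1 hs
  have hc : Continuous fun y : Vec d => Matrix.vecMulVec y.ofLp y.ofLp :=
    Continuous.matrix_vecMulVec (PiLp.continuous_ofLp 2 _) (PiLp.continuous_ofLp 2 _)
  exact hc.comp_stronglyMeasurable ((hx s (by omega)).mono (ℱ.mono hst.le))

lemma stronglyMeasurable_noiseSum (hx : ∀ t < T, StronglyMeasurable[ℱ t] (x t))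
    (hz : ∀ t < T, StronglyMeasurable[ℱ (t + 1)] (z t)) {t : ℕ}
    (ht : t ≤ T) :
    StronglyMeasurable[ℱ t] fun ω => noiseSum (fun s => x s ω) (fun s => z s ω) t := by
  unfold noiseSum
  refine Finset.stronglyMeasurable_fun_sum _ fun s hs => ?_
  have hst : s < t := Finset.mem_range.1 hs
  have hx' : StronglyMeasurable[ℱ t] fun ω => (x s ω).ofLp :=
    (PiLp.continuous_ofLp 2 _).comp_stronglyMeasurable ((hx s (by omega)).mono (ℱ.mono hst.le))
  exact ((hz s (by omega)).mono (ℱ.mono hst)).smul hx'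

/-- Self-normalized concentration for conditionally `1`-subgaussian noise. -/
lemma measure_exists_one_div_le_mixture {lam : ℝ} (hlam : 0 < lam)
    (hx : ∀ t < T, StronglyMeasurable[ℱ t] (x t))
    (hz : ∀ t < T, StronglyMeasurable[ℱ (t + 1)] (z t))
    (hs : ∀ t < T, CondSubgaussian μ (ℱ t) (z t) 1) {δ : ℝ} (hδ : 0 < δ) :
    μ {ω | ∃ t ≤ T, 1 / δ ≤ mixture lam (fun s => x s ω) (fun s => z s ω) t}
      ≤ ENNReal.ofReal δ := by
  have hA := fun {t} => stronglyMeasurable_design (t := t) hx lam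
  have hS := fun {t} => stronglyMeasurable_noiseSum (t := t) hx hz
  have hX : ∀ t < T, StronglyMeasurable[ℱ t] fun ω => (x t ω).ofLp := fun t ht =>
    (PiLp.continuous_ofLp 2 _).comp_stronglyMeasurable (hx t ht)
  let W : ℕ → Ω → ℝ≥0∞ := fun t ω =>
    ENNReal.ofReal (mixture lam (fun s => x s ω) (fun s => z s ω) t)
  have hW : ∀ t ≤ T, Measurable[ℱ t] (W t) := by
    intro t ht
    refine ENNReal.measurable_ofReal.comp ?_
    have h1 := (stronglyMeasurable_quad_inv (hA ht) (hS ht) (hS ht)).measurable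
    have h2 := ((continuous_id.matrix_det).comp_stronglyMeasurable (hA ht)).measurable
    exact (Real.measurable_exp.comp (h1.div_const 2)).div
      (Real.continuous_sqrt.measurable.comp (h2.div_const _))
  have hmix : ∀ t ω, 0 ≤ mixture lam (fun s => x s ω) (fun s => z s ω) t := fun t ω => by
    unfold mixture; positivity
  have key := measure_exists_le_of_supermartingale (μ := μ) ℱ (W := W) (N := T) hW
    (fun ω => by simp [W, mixture_zero hlam]) (by
      intro t ht s hs'
      have hu := stronglyMeasurable_quad_inv (hA ht.le) (hX t ht) (hX t ht)
      have hv := stronglyMeasurable_quad_inv (hA ht.le) (hX t ht) (hS ht.le)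
      have h := lintegral_mul_mixture_le (μ := μ) (ℱ.le t)
        (((hz t ht).measurable).mono (ℱ.le _) le_rfl) (hs t ht) hu.measurable hv.measurable
        (fun ω => quad_nonneg (posDef_design hlam _ t).inv.posSemidef _)
        (fun ω hω => by
          have hx0 : (x t ω).ofLp = 0 := by
            by_contra hne
            have := (posDef_design hlam (fun s => x s ω) t).inv.dotProduct_mulVec_pos hne
            simp only [star_trivial] at this
            exact this.ne' hω
          rw [hx0, zero_dotProduct])
        ((hW t ht.le).indicator hs')
      rw [← lintegral_indicator (ℱ.le _ _ hs'), ← lintegral_indicator (ℱ.le _ _ hs')]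
      refine le_trans (le_of_eq (lintegral_congr fun ω => ?_)) h
      by_cases hω : ω ∈ s
      · rw [Set.indicator_of_mem hω, Set.indicator_of_mem hω]
        simp only [W]
        rw [mixture_succ hlam, ENNReal.ofReal_mul (hmix t ω)]
      · simp [Set.indicator_of_notMem hω])
    (ENNReal.ofReal (1 / δ))
  have hset : {ω | ∃ t ≤ T, ENNReal.ofReal (1 / δ) ≤ W t ω}
      = {ω | ∃ t ≤ T, 1 / δ ≤ mixture lam (fun s => x s ω) (fun s => z s ω) t} := by
    ext ω
    simp only [Set.mem_ofPred_eq, W, ENNReal.ofReal_le_ofReal_iff (hmix _ ω)]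
  rw [hset] at key
  have hδ' : ENNReal.ofReal δ * ENNReal.ofReal (1 / δ) = 1 := by
    rw [← ENNReal.ofReal_mul hδ.le, mul_one_div_cancel hδ.ne', ENNReal.ofReal_one]
  calc _ = ENNReal.ofReal δ * (ENNReal.ofReal (1 / δ) *
        μ {ω | ∃ t ≤ T, 1 / δ ≤ mixture lam (fun s => x s ω) (fun s => z s ω) t}) := by
        rw [← mul_assoc, hδ', one_mul]
    _ ≤ ENNReal.ofReal δ * 1 := by gcongr
    _ = ENNReal.ofReal δ := mul_one _

lemma quad_lt_of_mixture_lt {lam : ℝ} (hlam : 0 < lam) {δ : ℝ} {x : ℕ → Vec d}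
    {z : ℕ → ℝ} {t : ℕ} (h : mixture lam x z t < 1 / δ) :
    noiseSum x z t ⬝ᵥ ((design lam x t)⁻¹ *ᵥ noiseSum x z t) <
      2 * Real.log (1 / δ) + (Real.log (design lam x t).det - d * Real.log lam) := by
  have hdet := (posDef_design hlam x t).det_pos
  have hl : (0 : ℝ) < lam ^ d := pow_pos hlam d
  have hpos : 0 < √((design lam x t).det / lam ^ d) := Real.sqrt_pos.2 (by positivity)
  unfold mixture at h
  have h1 := Real.log_lt_log (by positivity) h
  rw [Real.log_div (Real.exp_pos _).ne' hpos.ne', Real.log_exp, Real.log_sqrt (by positivity),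
    Real.log_div hdet.ne' hl.ne', Real.log_pow] at h1
  linarith

/-- For `R = 0` the noise cannot be normalized by `R`. Here `e^z + e^(-z) - 2` is nonnegative with
integral at most `0`, and it vanishes only at `z = 0`. -/
lemma CondSubgaussian.ae_eq_zero {z : Ω → ℝ} (hs : CondSubgaussian μ m z 0) (hm : m ≤ m₀) :
    ∀ᵐ ω ∂μ, z ω = 0 := by
  have hle : ∀ s : ℝ, ∫ ω, Real.exp (s * z ω) ∂μ ≤ 1 := by
    intro s
    rw [← integral_condExp hm]
    calc _ ≤ ∫ _, (1 : ℝ) ∂μ := integral_mono_ae integrable_condExp (integrable_const _) (by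
          simpa using (hs s).2)
      _ = 1 := by simp
  have hnn : ∀ ω, 0 ≤ Real.exp (1 * z ω) + Real.exp (-1 * z ω) - 2 := by
    intro ω
    have h := Real.add_one_le_exp (1 * z ω)
    have h' := Real.add_one_le_exp (-1 * z ω)
    linarith
  have hexp : Integrable (fun ω => Real.exp (1 * z ω) + Real.exp (-1 * z ω) - 2) μ :=
    ((hs 1).1.add (hs (-1)).1).sub (integrable_const _)
  have h0 : ∫ ω, (Real.exp (1 * z ω) + Real.exp (-1 * z ω) - 2) ∂μ = 0 := by
    refine le_antisymm ?_ (integral_nonneg hnn)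
    have hadd : Integrable (fun ω => Real.exp (1 * z ω) + Real.exp (-1 * z ω)) μ :=
      (hs 1).1.add (hs (-1)).1
    rw [integral_sub hadd (integrable_const _), integral_add (hs 1).1 (hs (-1)).1]
    simp only [integral_const, probReal_univ, smul_eq_mul]
    linarith [hle 1, hle (-1)]
  rw [integral_eq_zero_iff_of_nonneg hnn hexp] at h0
  filter_upwards [h0] with ω hω
  by_contra hne
  have h := Real.add_one_lt_exp (x := 1 * z ω) (by simpa using hne)
  have h' := Real.add_one_lt_exp (x := -1 * z ω) (by simpa using hne)
  simp only [Pi.zero_apply] at hω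
  linarith

/-- Self-normalized concentration for conditionally `R`-subgaussian noise. -/
theorem measure_exists_lt_quad_noiseSum {lam R : ℝ} (hlam : 0 < lam) (hR : 0 ≤ R)
    (hx : ∀ t < T, StronglyMeasurable[ℱ t] (x t))
    (hz : ∀ t < T, StronglyMeasurable[ℱ (t + 1)] (z t))
    (hs : ∀ t < T, CondSubgaussian μ (ℱ t) (z t) R) {δ : ℝ} (hδ : 0 < δ) :
    μ {ω | ∃ t ≤ T, R ^ 2 * (2 * Real.log (1 / δ)
        + (Real.log (design lam (fun s => x s ω) t).det - d * Real.log lam)) <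
      noiseSum (fun s => x s ω) (fun s => z s ω) t ⬝ᵥ ((design lam (fun s => x s ω) t)⁻¹ *ᵥ
        noiseSum (fun s => x s ω) (fun s => z s ω) t)} ≤ ENNReal.ofReal δ := by
  rcases hR.eq_or_lt with rfl | hR
  · have hae : ∀ᵐ ω ∂μ, ∀ t < T, z t ω = 0 := by
      rw [ae_all_iff]
      intro t
      by_cases ht : t < T
      · filter_upwards [(hs t ht).ae_eq_zero (ℱ.le t)] with ω hω _ using hω
      · exact Filter.Eventually.of_forall fun ω h => absurd h ht
    refine le_trans (le_of_eq ?_) zero_le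
    rw [measure_eq_zero_iff_ae_notMem]
    filter_upwards [hae] with ω hω
    rintro ⟨t, ht, h⟩
    have : noiseSum (fun s => x s ω) (fun s => z s ω) t = 0 := by
      unfold noiseSum
      refine Finset.sum_eq_zero fun s hs => ?_
      simp only [hω s (by have := Finset.mem_range.1 hs; omega), zero_smul]
    simp [this] at h
  · have hs' : ∀ t < T, CondSubgaussian μ (ℱ t) (fun ω => z t ω / R) 1 := by
      intro t ht s
      have h := hs t ht (s / R)
      have e1 : (fun ω => Real.exp (s / R * z t ω)) = fun ω => Real.exp (s * (z t ω / R)) := by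
        ext ω; congr 1; ring
      have e2 : (s / R) ^ 2 * R ^ 2 / 2 = s ^ 2 * 1 ^ 2 / 2 := by field_simp
      rwa [e1, e2] at h
    refine le_trans (measure_mono ?_) (measure_exists_one_div_le_mixture hlam hx
      (z := fun t ω => z t ω / R) (fun t ht => ((hz t ht).measurable.div_const R).stronglyMeasurable) hs' hδ)
    rintro ω ⟨t, ht, h⟩
    refine ⟨t, ht, ?_⟩
    by_contra! hlt
    have h2 := quad_lt_of_mixture_lt hlam hlt
    have e : noiseSum (fun s => x s ω) (fun s => z s ω / R) t
        = R⁻¹ • noiseSum (fun s => x s ω) (fun s => z s ω) t := by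
      unfold noiseSum
      rw [Finset.smul_sum]
      refine Finset.sum_congr rfl fun s _ => ?_
      rw [smul_smul]; congr 1; ring
    rw [e, Matrix.mulVec_smul, smul_dotProduct, dotProduct_smul, smul_smul, smul_eq_mul] at h2
    have h3 : 0 < R ^ 2 := by positivity
    have h4 := mul_lt_mul_of_pos_left h2 h3
    have h5 : ∀ q : ℝ, R ^ 2 * (R⁻¹ * R⁻¹ * q) = q := fun q => by field_simp
    rw [h5] at h4
    exact lt_asymm h h4

end SelfNormalized

/-! ### Invariants of the dyadic sketch -/

section Sketch

variable {d : ℕ}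

lemma dotProduct_self_ofLp (x : Vec d) : x.ofLp ⬝ᵥ x.ofLp = ‖x‖ ^ 2 := by
  rw [EuclideanSpace.real_norm_sq_eq]
  simp [dotProduct, sq]

lemma trace_vecMulVec_self (x : Vec d) : (Matrix.vecMulVec x.ofLp x.ofLp).trace = ‖x‖ ^ 2 := by
  rw [Matrix.trace_vecMulVec, dotProduct_self_ofLp]

lemma rank_add_le (A B : Matrix (Fin d) (Fin d) ℝ) : (A + B).rank ≤ A.rank + B.rank := by
  unfold Matrix.rank
  rw [Matrix.mulVecLin_add]
  exact (Submodule.finrank_mono (LinearMap.range_add_le _ _)).trans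
    (Submodule.finrank_add_le_finrank_add_finrank _ _)

lemma posSemidef_transpose_mul_self {l : ℕ} (S : Matrix (Fin l) (Fin d) ℝ) :
    (Sᵀ * S).PosSemidef := by
  simpa using Matrix.posSemidef_conjTranspose_mul_self S

namespace Block

/-- Overwriting the last row loses nothing because that row is zero; shrinking by the least singular
value keeps it so. -/
lemma gram_append (b : Block d) (x : Vec d) (h : b.sketch b.last = 0) :
    (b.append x)ᵀ * b.append x = b.sketchᵀ * b.sketch + Matrix.vecMulVec x.ofLp x.ofLp := by
  ext i j
  simp only [Matrix.mul_apply, Matrix.transpose_apply, Matrix.add_apply, Matrix.vecMulVec_apply,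
    append]
  rw [← Finset.add_sum_erase _ _ (Finset.mem_univ b.last),
    ← Finset.add_sum_erase (f := fun k => b.sketch k i * b.sketch k j) _ (Finset.mem_univ b.last)]
  have h1 : ∀ j, b.sketch b.last j = 0 := fun j => congrFun h j
  have h2 : ∑ k ∈ Finset.univ.erase b.last, b.sketch.updateRow b.last x.ofLp k i
      * b.sketch.updateRow b.last x.ofLp k j
      = ∑ k ∈ Finset.univ.erase b.last, b.sketch k i * b.sketch k j := by
    refine Finset.sum_congr rfl fun k hk => ?_
    rw [Matrix.updateRow_ne (Finset.ne_of_mem_erase hk)]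
  rw [h2, Matrix.updateRow_self, h1, h1]
  ring

lemma antitone_last_le {b : Block d} {s : Fin b.len → ℝ} (hs : Antitone s) (i : Fin b.len) :
    s b.last ≤ s i := by
  refine hs (Fin.le_def.2 ?_)
  simp only [last]
  have := i.2
  omega

/-- The effect of one update of a block on its Gram matrix. -/
lemma Update.exists_shrink {b b' : Block d} {x : Vec d} (hb : b.Update x b')
    (h : b.sketch b.last = 0) :
    ∃ (V : Matrix (Fin d) (Fin b.len) ℝ) (σ : ℝ), Vᵀ * V = 1 ∧ 0 ≤ σ ∧ b'.len = b.len ∧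
      b'.sketch b'.last = 0 ∧ b'.size = b.size + ‖x‖ ^ 2 ∧ b'.counter = b.counter + σ ∧
      b'.sketchᵀ * b'.sketch
        = b.sketchᵀ * b.sketch + Matrix.vecMulVec x.ofLp x.ofLp - σ • (V * Vᵀ) ∧
      (σ ≠ 0 → b.len ≤ (b.append x).rank ∧ ∀ w, b.append x *ᵥ w = 0 → Vᵀ *ᵥ w = 0) := by
  obtain ⟨U, s, V, hsvd, rfl⟩ := hb
  have hlast := fun i => antitone_last_le hsvd.antitone i
  have hUQ : Uᵀ * b.append x = Matrix.diagonal s * Vᵀ := by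
    rw [hsvd.eq_mul, ← Matrix.mul_assoc, ← Matrix.mul_assoc, hsvd.orthogonal_left, Matrix.one_mul]
  refine ⟨V, s b.last ^ 2, hsvd.orthonormal_right, sq_nonneg _, rfl, ?_, rfl, rfl, ?_, ?_⟩
  -- The last diagonal entry is `√(σ_l² - σ_l²) = 0`.
  · ext j
    simp [Matrix.diagonal_mul, last]
  · rw [← gram_append b x h]
    have h1 : (b.append x)ᵀ * b.append x = V * Matrix.diagonal (fun i => s i ^ 2) * Vᵀ := by
      rw [hsvd.eq_mul]
      simp only [Matrix.transpose_mul, Matrix.transpose_transpose, Matrix.diagonal_transpose]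
      calc V * (Matrix.diagonal s * Uᵀ) * (U * Matrix.diagonal s * Vᵀ)
          = V * (Matrix.diagonal s * (Uᵀ * U) * Matrix.diagonal s) * Vᵀ := by
            simp only [Matrix.mul_assoc]
        _ = _ := by
          rw [hsvd.orthogonal_left, Matrix.mul_one, Matrix.diagonal_mul_diagonal]
          simp only [sq]
    have h2 : Matrix.diagonal (fun i => √(s i ^ 2 - s b.last ^ 2))
        * Matrix.diagonal (fun i => √(s i ^ 2 - s b.last ^ 2))
        = Matrix.diagonal (fun i => s i ^ 2) - s b.last ^ 2 • (1 : Matrix (Fin b.len) _ ℝ) := by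
      rw [Matrix.diagonal_mul_diagonal, ← Matrix.diagonal_one, ← Matrix.diagonal_smul,
        Matrix.diagonal_sub]
      congr 1
      ext i
      rw [Real.mul_self_sqrt]
      · simp
      · have := hlast i
        have := hsvd.nonneg b.last
        nlinarith
    simp only [Matrix.transpose_mul, Matrix.transpose_transpose, Matrix.diagonal_transpose]
    rw [Matrix.mul_assoc V, ← Matrix.mul_assoc (Matrix.diagonal _), h2, h1, ← Matrix.mul_assoc,
      Matrix.mul_sub, Matrix.sub_mul, Matrix.mul_smul, Matrix.mul_one, Matrix.smul_mul]
  -- If the least singular value is nonzero, all are positive. Then `Σ` is invertible, the appended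
  -- sketch has full row rank, and its kernel is contained in that of `Vᵀ`.
  · intro hσ
    have hpos : ∀ i, 0 < s i := fun i =>
      lt_of_lt_of_le (lt_of_le_of_ne (hsvd.nonneg _) fun h0 => hσ (by rw [← h0]; simp)) (hlast i)
    constructor
    · have hQV : b.append x * V = U * Matrix.diagonal s := by
        rw [hsvd.eq_mul, Matrix.mul_assoc, hsvd.orthonormal_right, Matrix.mul_one]
      have hunit : IsUnit (U * Matrix.diagonal s) := by
        refine IsUnit.mul ?_ ?_
        · exact (Matrix.isUnit_iff_isUnit_det _).2
            (Matrix.isUnit_det_of_left_inverse hsvd.orthogonal_left)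
        · rw [Matrix.isUnit_diagonal, Pi.isUnit_iff]
          exact fun i => isUnit_iff_ne_zero.2 (hpos i).ne'
      have := Matrix.rank_mul_le_left (b.append x) V
      rwa [hQV, Matrix.rank_of_isUnit _ hunit, Fintype.card_fin] at this
    · intro w hw
      have h1 : (Matrix.diagonal s * Vᵀ) *ᵥ w = 0 := by
        rw [← hUQ, ← Matrix.mulVec_mulVec, hw, Matrix.mulVec_zero]
      rw [← Matrix.mulVec_mulVec] at h1
      ext i
      have h2 := congrFun h1 i
      rw [Matrix.mulVec_diagonal] at h2
      simpa [(hpos i).ne'] using h2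

lemma trace_shrink {l : ℕ} {V : Matrix (Fin d) (Fin l) ℝ} (hV : Vᵀ * V = 1) (σ : ℝ) :
    (σ • (V * Vᵀ)).trace = l * σ := by
  rw [Matrix.trace_smul, Matrix.trace_mul_comm, hV, Matrix.trace_one]
  simp [mul_comm]

/-- Since a newly opened block has length at least `2`, its first row causes no shrinking. -/
lemma rank_append_fresh_le (l : ℕ) (hl : 0 < l) (x : Vec d) :
    ((fresh d l hl).append x).rank ≤ 1 := by
  have : (fresh d l hl).append x
      = Matrix.vecMulVec (Pi.single (fresh d l hl).last 1) x.ofLp := by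
    ext i j
    by_cases hi : i = (fresh d l hl).last
    · subst hi
      simp [append, Matrix.vecMulVec_apply]
    · rw [append, Matrix.updateRow_ne hi, Matrix.vecMulVec_apply, Pi.single_eq_of_ne hi, zero_mul]
      rfl
  rw [this]
  exact Matrix.rank_vecMulVec_le _ _

end Block

namespace State

/-- The Gram matrix of the inactive blocks. -/
def inactiveGram (st : State d) : Matrix (Fin d) (Fin d) ℝ :=
  (st.inactive.map fun b => b.sketchᵀ * b.sketch).sum

/-- `∑ᵢ lᵢ σ̄ᵢ`. -/
noncomputable def weightedCounter (st : State d) : ℝ :=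
  (st.blocks.map fun b => (b.len : ℝ) * b.counter).sum

lemma gram_eq (st : State d) :
    st.gram = st.inactiveGram + st.active.sketchᵀ * st.active.sketch + st.full := by
  simp [gram, blocks, inactiveGram]

lemma counter_eq (st : State d) :
    st.counter = (st.inactive.map fun b => b.counter).sum + st.active.counter := by
  simp [counter, blocks]

lemma weightedCounter_eq (st : State d) :
    st.weightedCounter = (st.inactive.map fun b => (b.len : ℝ) * b.counter).sum
      + st.active.len * st.active.counter := by
  simp [weightedCounter, blocks]

lemma posSemidef_listSum {α : Type*} (L : List α) (f : α → Matrix (Fin d) (Fin d) ℝ)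
    (hf : ∀ a, (f a).PosSemidef) : (L.map f).sum.PosSemidef := by
  induction L with
  | nil => simpa using Matrix.PosSemidef.zero
  | cons a L ih => simpa using (hf a).add ih

lemma posSemidef_inactiveGram (st : State d) : st.inactiveGram.PosSemidef :=
  posSemidef_listSum _ _ fun b => posSemidef_transpose_mul_self b.sketch

lemma rank_gram_le {l : ℕ} (S : Matrix (Fin l) (Fin d) ℝ) : (Sᵀ * S).rank ≤ l := by
  rw [Matrix.rank_transpose_mul_self]
  simpa using Matrix.rank_le_card_height S

lemma rank_inactiveGram_le (st : State d) :
    st.inactiveGram.rank ≤ (st.inactive.map fun b => b.len).sum := by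
  unfold inactiveGram
  induction st.inactive with
  | nil => simp
  | cons a L ih =>
    simp only [List.map_cons, List.sum_cons]
    exact (rank_add_le _ _).trans (add_le_add (rank_gram_le _) ih)

/-- What holds for the state of the sketch after the rows `x 0, …, x (t - 1)`. -/
structure Inv (l₀ : ℕ) (ε : ℝ) (x : ℕ → Vec d) (t : ℕ) (st : State d) : Prop where
  last_zero : st.active.sketch st.active.last = 0
  counter_nonneg : ∀ b ∈ st.blocks, 0 ≤ b.counter
  size_eq : st.active.size
    = (st.active.sketchᵀ * st.active.sketch).trace + st.active.len * st.active.counter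
  len_mul_counter_le : st.active.len * st.active.counter ≤ ε * l₀
  len_eq : st.active.len = l₀ * 2 ^ st.inactive.length
  sum_len : (st.inactive.map fun b => b.len).sum + l₀ = st.active.len
  -- The term `2 ε l₀ / l_B` is the allowance left for the active block and all later ones; as the
  -- length doubles, a split releases `ε l₀ / l_B`, which covers the counter of the closed block.
  sum_counter_le :
    (st.inactive.map fun b => b.counter).sum + 2 * (ε * l₀ / st.active.len) ≤ 2 * ε
  full_eq_zero : ¬ st.LimitReached l₀ → st.full = 0
  full_posSemidef : st.full.PosSemidef
  trace_eq : st.gram.trace + st.weightedCounter = ∑ s ∈ Finset.range t, ‖x s‖ ^ 2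
  lower : (st.gram + st.counter • (1 : Matrix (Fin d) (Fin d) ℝ)
    - ∑ s ∈ Finset.range t, Matrix.vecMulVec (x s).ofLp (x s).ofLp).PosSemidef
  upper : (∑ s ∈ Finset.range t, Matrix.vecMulVec (x s).ofLp (x s).ofLp - st.gram).PosSemidef

/-- One step adds the new row to the Gram matrix, up to shrinking by `σ`, which is added to the
counter. -/
structure Shrink (st : State d) (x : Vec d) (st' : State d) {l : ℕ}
    (V : Matrix (Fin d) (Fin l) ℝ) (σ : ℝ) : Prop where
  orthonormal : Vᵀ * V = 1
  nonneg : 0 ≤ σ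
  gram_eq : st'.gram = st.gram + Matrix.vecMulVec x.ofLp x.ofLp - σ • (V * Vᵀ)
  counter_eq : st'.counter = st.counter + σ
  weightedCounter_eq : st'.weightedCounter = st.weightedCounter + l * σ
  len_le : st.activeLen ≤ st'.activeLen
  -- Required only for genuine shrinking: once rows are stored exactly the rank may exceed `2 l_B`,
  -- but then `σ = 0`.
  rank_le : σ ≠ 0 → (st.gram + Matrix.vecMulVec x.ofLp x.ofLp).rank ≤ 2 * st.activeLen
  ker_le : σ ≠ 0 → ∀ w, (st.gram + Matrix.vecMulVec x.ofLp x.ofLp) *ᵥ w = 0 → Vᵀ *ᵥ w = 0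

variable {l₀ : ℕ} {ε : ℝ} {x : ℕ → Vec d} {t : ℕ} {st st' : State d}

lemma Inv.posSemidef_gram (h : Inv l₀ ε x t st) : st.gram.PosSemidef := by
  rw [gram_eq]
  exact (st.posSemidef_inactiveGram.add (posSemidef_transpose_mul_self _)).add h.full_posSemidef

lemma Inv.l₀_pos (h : Inv l₀ ε x t st) : 0 < l₀ := by
  rcases Nat.eq_zero_or_pos l₀ with h0 | h0
  · have := h.len_eq
    have := st.active.len_pos
    simp_all
  · exact h0

lemma Inv.counter_nonneg' (h : Inv l₀ ε x t st) : 0 ≤ st.counter := by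
  unfold counter
  refine List.sum_nonneg ?_
  simpa using h.counter_nonneg

lemma Inv.weightedCounter_nonneg (h : Inv l₀ ε x t st) : 0 ≤ st.weightedCounter := by
  unfold weightedCounter
  refine List.sum_nonneg ?_
  simp only [List.mem_map, forall_exists_index, and_imp, forall_apply_eq_imp_iff₂]
  exact fun b hb => mul_nonneg (Nat.cast_nonneg _) (h.counter_nonneg b hb)

lemma Inv.active_counter_le (h : Inv l₀ ε x t st) :
    st.active.counter ≤ ε * l₀ / st.active.len := by
  have : (0 : ℝ) < st.active.len := by exact_mod_cast st.active.len_pos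
  rw [le_div_iff₀ this]
  linarith [h.len_mul_counter_le]

lemma Inv.counter_le (h : Inv l₀ ε x t st) (hε : 0 ≤ ε) : st.counter ≤ 2 * ε := by
  have h1 := h.active_counter_le
  have h2 := h.sum_counter_le
  have : 0 ≤ ε * l₀ / st.active.len := by positivity
  rw [counter_eq]
  linarith

lemma Inv.rank_gram_le_of_not_limit (h : Inv l₀ ε x t st) (hl : ¬ st.LimitReached l₀) :
    st.gram.rank ≤ 2 * st.activeLen := by
  rw [gram_eq, h.full_eq_zero hl, add_zero]
  have h1 := rank_add_le st.inactiveGram (st.active.sketchᵀ * st.active.sketch)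
  have h2 := rank_gram_le st.active.sketch
  have h3 := st.rank_inactiveGram_le
  have h4 := h.sum_len
  unfold activeLen
  omega

/-- The limit condition means `d / l₀ + 1 < 2^(B + 1)` for `B` blocks, while `l_B = l₀ 2^(B - 1)`.
-/
lemma Inv.lt_of_limitReached (h : Inv l₀ ε x t st) (hl : st.LimitReached l₀) :
    d ≤ 2 * (2 * st.activeLen) := by
  have hl0 : (0 : ℝ) < l₀ := by exact_mod_cast h.l₀_pos
  unfold LimitReached at hl
  have h1 : ⌊Real.logb 2 ((d : ℝ) / l₀ + 1)⌋ < (st.inactive.length : ℤ) + 2 := by omega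
  rw [Int.floor_lt] at h1
  push_cast at h1
  rw [Real.logb_lt_iff_lt_rpow (by norm_num) (by positivity)] at h1
  have h2 : (2 : ℝ) ^ ((st.inactive.length : ℝ) + 2) = 2 ^ (st.inactive.length + 2) := by
    rw [← Real.rpow_natCast]; push_cast; rfl
  rw [h2] at h1
  have h3 : (d : ℝ) < l₀ * 2 ^ (st.inactive.length + 2) := by
    have : (d : ℝ) / l₀ < 2 ^ (st.inactive.length + 2) := by linarith
    rwa [div_lt_iff₀' hl0] at this
  have h4 : d < l₀ * 2 ^ (st.inactive.length + 2) := by exact_mod_cast h3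
  have h5 := h.len_eq
  unfold activeLen
  rw [h5]
  rw [pow_add] at h4
  nlinarith

/-- Covers the steps without shrinking. The matrix `V` is then irrelevant, and one with no columns
will do. -/
lemma Shrink.of_gram_eq (hg : st'.gram = st.gram + Matrix.vecMulVec (x t).ofLp (x t).ofLp)
    (hc : st'.counter = st.counter) (hw : st'.weightedCounter = st.weightedCounter)
    (hl : st.activeLen ≤ st'.activeLen) (l : ℕ) (V : Matrix (Fin d) (Fin l) ℝ) (hV : Vᵀ * V = 1) :
    Shrink st (x t) st' V 0 where
  orthonormal := hV
  nonneg := le_rfl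
  gram_eq := by simp [hg]
  counter_eq := by simp [hc]
  weightedCounter_eq := by simp [hw]
  len_le := hl
  rank_le := fun h => absurd rfl h
  ker_le := fun h => absurd rfl h

lemma Shrink.of_update (h : Inv l₀ ε x t st) (hlim : ¬ st.LimitReached l₀)
    {V : Matrix (Fin d) (Fin st.active.len) ℝ} {σ : ℝ} (hV : Vᵀ * V = 1) (hσ : 0 ≤ σ) {b : Block d}
    (hlen : b.len = st.active.len) (hc : b.counter = st.active.counter + σ)
    (hg : b.sketchᵀ * b.sketch = st.active.sketchᵀ * st.active.sketch
      + Matrix.vecMulVec (x t).ofLp (x t).ofLp - σ • (V * Vᵀ))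
    (hker : σ ≠ 0 → ∀ w, st.active.append (x t) *ᵥ w = 0 → Vᵀ *ᵥ w = 0) :
    Shrink st (x t) { inactive := st.inactive, active := b, full := st.full } V σ where
  orthonormal := hV
  nonneg := hσ
  gram_eq := by
    rw [State.gram_eq, State.gram_eq]
    simp only [inactiveGram, hg]
    abel
  counter_eq := by
    rw [State.counter_eq, State.counter_eq]
    simp only [hc]
    ring
  weightedCounter_eq := by
    rw [State.weightedCounter_eq, State.weightedCounter_eq]
    simp only [hc, hlen]
    ring
  len_le := hlen.symm.le
  rank_le := fun _ => by
    have h1 : st.gram + Matrix.vecMulVec (x t).ofLp (x t).ofLp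
        = st.inactiveGram + (st.active.append (x t))ᵀ * st.active.append (x t) := by
      rw [State.gram_eq, h.full_eq_zero hlim, Block.gram_append _ _ h.last_zero]
      abel
    rw [h1]
    have h2 := rank_add_le st.inactiveGram ((st.active.append (x t))ᵀ * st.active.append (x t))
    have h3 := rank_gram_le (st.active.append (x t))
    have h4 := st.rank_inactiveGram_le
    have h5 := h.sum_len
    unfold activeLen
    omega
  ker_le := fun h0 w hw => hker h0 w (by
    -- The full Gram matrix dominates that of the appended active sketch, so a vector in its kernel
    -- is also annihilated by the appended sketch.
    have h1 : ((st.gram + Matrix.vecMulVec (x t).ofLp (x t).ofLp)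
        - (st.active.append (x t))ᵀ * st.active.append (x t)).PosSemidef := by
      have : (st.gram + Matrix.vecMulVec (x t).ofLp (x t).ofLp)
          - (st.active.append (x t))ᵀ * st.active.append (x t) = st.inactiveGram + st.full := by
        rw [State.gram_eq, Block.gram_append _ _ h.last_zero]
        abel
      rw [this]
      exact st.posSemidef_inactiveGram.add h.full_posSemidef
    have h2 := quad_le_quad h1 w
    rw [hw, dotProduct_zero, ← Matrix.mulVec_mulVec, Matrix.dotProduct_mulVec,
      Matrix.vecMul_transpose] at h2
    exact dotProduct_self_eq_zero.1
      (le_antisymm h2 (Finset.sum_nonneg fun i _ => mul_self_nonneg _)))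

/-- The parts of the invariant that follow from the description of the step alone. -/
lemma Inv.of_shrink (h : Inv l₀ ε x t st) {l : ℕ} {V : Matrix (Fin d) (Fin l) ℝ} {σ : ℝ}
    (hs : Shrink st (x t) st' V σ) :
    st'.gram.trace + st'.weightedCounter = ∑ s ∈ Finset.range (t + 1), ‖x s‖ ^ 2 ∧
    (st'.gram + st'.counter • (1 : Matrix (Fin d) (Fin d) ℝ)
      - ∑ s ∈ Finset.range (t + 1), Matrix.vecMulVec (x s).ofLp (x s).ofLp).PosSemidef ∧
    (∑ s ∈ Finset.range (t + 1), Matrix.vecMulVec (x s).ofLp (x s).ofLp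
      - st'.gram).PosSemidef := by
  refine ⟨?_, ?_, ?_⟩
  · rw [Finset.sum_range_succ, ← h.trace_eq, hs.gram_eq, hs.weightedCounter_eq, Matrix.trace_sub,
      Matrix.trace_add, Block.trace_shrink hs.orthonormal, trace_vecMulVec_self]
    ring
  · have : st'.gram + st'.counter • (1 : Matrix (Fin d) (Fin d) ℝ)
        - ∑ s ∈ Finset.range (t + 1), Matrix.vecMulVec (x s).ofLp (x s).ofLp
        = (st.gram + st.counter • (1 : Matrix (Fin d) (Fin d) ℝ)
          - ∑ s ∈ Finset.range t, Matrix.vecMulVec (x s).ofLp (x s).ofLp)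
          + σ • (1 - V * Vᵀ) := by
      rw [Finset.sum_range_succ, hs.gram_eq, hs.counter_eq, add_smul, smul_sub]
      abel
    rw [this]
    exact h.lower.add ((posSemidef_one_sub_mul_transpose hs.orthonormal).smul hs.nonneg)
  · have : ∑ s ∈ Finset.range (t + 1), Matrix.vecMulVec (x s).ofLp (x s).ofLp - st'.gram
        = (∑ s ∈ Finset.range t, Matrix.vecMulVec (x s).ofLp (x s).ofLp - st.gram)
          + σ • (V * Vᵀ) := by
      rw [Finset.sum_range_succ, hs.gram_eq]
      abel
    rw [this]
    have hVV : (V * Vᵀ).PosSemidef := by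
      simpa using posSemidef_transpose_mul_self Vᵀ
    exact h.upper.add (hVV.smul hs.nonneg)

lemma fresh_last_zero (l : ℕ) (hl : 0 < l) :
    (Block.fresh d l hl).sketch (Block.fresh d l hl).last = 0 := rfl

lemma fresh_gram (l : ℕ) (hl : 0 < l) :
    (Block.fresh d l hl).sketchᵀ * (Block.fresh d l hl).sketch = 0 := Matrix.mul_zero _

lemma Inv.init (h : 0 < l₀) (ε : ℝ) (hε : 0 ≤ ε) (x : ℕ → Vec d) :
    Inv l₀ ε x 0 (State.init d l₀ h) := by
  have hl : (l₀ : ℝ) ≠ 0 := by positivity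
  have hS : (State.init d l₀ h).active.sketchᵀ * (State.init d l₀ h).active.sketch = 0 :=
    fresh_gram l₀ h
  have hg : (State.init d l₀ h).gram = 0 := by
    rw [gram_eq, hS]; simp [State.init, inactiveGram]
  have hc : (State.init d l₀ h).counter = 0 := by
    rw [counter_eq]; simp [State.init, Block.fresh]
  have hw : (State.init d l₀ h).weightedCounter = 0 := by
    rw [weightedCounter_eq]; simp [State.init, Block.fresh]
  constructor
  · exact fresh_last_zero _ _
  · simp [blocks, State.init, Block.fresh]
  · rw [hS]
    simp [State.init, Block.fresh]
  · simp only [State.init, Block.fresh, mul_zero]; positivity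
  · simp [State.init, Block.fresh]
  · simp [State.init, Block.fresh]
  · simp [State.init, Block.fresh, hl]
  · intro _; rfl
  · exact Matrix.PosSemidef.zero
  · simp [hg, hw]
  · simpa [hg, hc] using Matrix.PosSemidef.zero
  · simpa [hg] using Matrix.PosSemidef.zero

/-- A step keeps the invariant and is described by one shrinking value. -/
theorem Inv.step (h : Inv l₀ ε x t st) (hst : Step l₀ ε st (x t) st') :
    Inv l₀ ε x (t + 1) st' ∧
      ∃ (l : ℕ) (V : Matrix (Fin d) (Fin l) ℝ) (σ : ℝ), Shrink st (x t) st' V σ := by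
  cases hst with
  | rankOne hlim =>
    have hs := Shrink.of_gram_eq (x := x) (t := t) (st := st)
      (st' := { inactive := st.inactive, active := st.active,
                full := st.full + Matrix.vecMulVec (x t).ofLp (x t).ofLp })
      (by rw [gram_eq, gram_eq]; simp only [inactiveGram]; abel) rfl rfl le_rfl 0 0
      (Subsingleton.elim _ _)
    obtain ⟨h1, h2, h3⟩ := h.of_shrink hs
    refine ⟨⟨h.last_zero, h.counter_nonneg, h.size_eq, h.len_mul_counter_le, h.len_eq, h.sum_len,
      h.sum_counter_le, fun hn => absurd hlim hn, h.full_posSemidef.add (posSemidef_vecMulVec _),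
      h1, h2, h3⟩, 0, 0, 0, hs⟩
  | update hlim hsplit b hb =>
    obtain ⟨V, σ, hV, hσ, hlen, hlast, hsize, hc, hg, hne⟩ := hb.exists_shrink h.last_zero
    have hs := Shrink.of_update h hlim hV hσ hlen hc hg (fun h0 => (hne h0).2)
    obtain ⟨h1, h2, h3⟩ := h.of_shrink hs
    have hsize' : b.size = (b.sketchᵀ * b.sketch).trace + b.len * b.counter := by
      rw [hsize, h.size_eq, hg, Matrix.trace_sub, Matrix.trace_add, Block.trace_shrink hV,
        trace_vecMulVec_self, hlen, hc]
      ring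
    refine ⟨⟨hlast, ?_, hsize', ?_, ?_, ?_, ?_, fun hn => h.full_eq_zero hlim,
      h.full_posSemidef, h1, h2, h3⟩, _, V, σ, hs⟩
    · intro b' hb'
      simp only [blocks, List.mem_append, List.mem_singleton] at hb'
      rcases hb' with hb' | rfl
      · exact h.counter_nonneg b' (by simp [blocks, hb'])
      · rw [hc]
        exact add_nonneg (h.counter_nonneg _ (by simp [blocks])) hσ
    -- Nonzero shrinking means full rank, so the absence of a split forces the new size to be at
    -- most `ε l₀`; the size is the trace plus length times counter.
    · by_cases h0 : σ = 0
      · simp only [hlen, hc, h0, add_zero]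
        exact h.len_mul_counter_le
      · have hsz : st.active.size + ‖x t‖ ^ 2 ≤ ε * l₀ := by
          by_contra! hlt
          exact hsplit ⟨hlt, (hne h0).1⟩
        have := (posSemidef_transpose_mul_self b.sketch).trace_nonneg
        simp only
        linarith
    · simp only [hlen]; exact h.len_eq
    · simp only [hlen]; exact h.sum_len
    · simp only [hlen]; exact h.sum_counter_le
  | split hlim hsplit b hb =>
    obtain ⟨V, σ, hV, hσ, hlen, hlast, hsize, hc, hg, hne⟩ :=
      hb.exists_shrink (fresh_last_zero _ _)
    have hσ0 : σ = 0 := by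
      by_contra h0
      have h1 := (hne h0).1
      have h2 := Block.rank_append_fresh_le (2 * st.active.len)
        (Nat.mul_pos Nat.two_pos st.active.len_pos) (x t)
      have h3 := st.active.len_pos
      have h4 : (Block.fresh d (2 * st.active.len)
        (Nat.mul_pos Nat.two_pos st.active.len_pos)).len = 2 * st.active.len := rfl
      omega
    have hlen' : b.len = 2 * st.active.len := hlen
    have hc' : b.counter = 0 := by rw [hc, hσ0]; simp [Block.fresh]
    have hg' : b.sketchᵀ * b.sketch = Matrix.vecMulVec (x t).ofLp (x t).ofLp := by
      rw [hg, hσ0, fresh_gram]; simp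
    have hlpos : (0 : ℝ) < st.active.len := by exact_mod_cast st.active.len_pos
    have hs := Shrink.of_gram_eq (x := x) (t := t) (st := st)
      (st' := { inactive := st.inactive ++ [st.active], active := b, full := st.full })
      (by rw [gram_eq, gram_eq]; simp only [inactiveGram, hg']; simp; abel)
      (by rw [counter_eq, counter_eq]; simp [hc'])
      (by rw [weightedCounter_eq, weightedCounter_eq]; simp [hc'])
      (by simp only [activeLen, hlen']; omega) 0 0 (Subsingleton.elim _ _)
    obtain ⟨h1, h2, h3⟩ := h.of_shrink hs
    refine ⟨⟨hlast, ?_, ?_, ?_, ?_, ?_, ?_, fun hn => h.full_eq_zero hlim,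
      h.full_posSemidef, h1, h2, h3⟩, 0, 0, 0, hs⟩
    · intro b' hb'
      simp only [blocks, List.mem_append, List.mem_singleton] at hb'
      rcases hb' with hb' | rfl
      · exact h.counter_nonneg b' (by simpa [blocks] using hb')
      · exact hc'.ge
    · simp only [hg', hc', trace_vecMulVec_self, hsize]
      simp [Block.fresh]
    · simp only [hc', mul_zero]
      refine le_trans ?_ h.len_mul_counter_le
      exact mul_nonneg hlpos.le (h.counter_nonneg _ (by simp [blocks]))
    · simp only [hlen', h.len_eq, List.length_append, List.length_singleton, pow_succ]
      ring
    · have := h.sum_len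
      simp only [List.map_append, List.map_cons, List.map_nil, List.sum_append, List.sum_cons,
        List.sum_nil, hlen']
      omega
    · have e1 := h.sum_counter_le
      have e2 := h.active_counter_le
      have e3 : ε * l₀ / ((2 * st.active.len : ℕ) : ℝ) = ε * l₀ / st.active.len / 2 := by
        push_cast; field_simp
      simp only [List.map_append, List.map_cons, List.map_nil, List.sum_append, List.sum_cons,
        List.sum_nil, hlen', e3]
      linarith

end State

end Sketch

/-! ### Confidence ellipsoid and elliptical potential -/

section Regret

variable {d : ℕ} {p : Params} {x : ℕ → Vec d} {t : ℕ} {st st' : State d}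

lemma inner_eq_dotProduct (x y : Vec d) : inner ℝ x y = x.ofLp ⬝ᵥ y.ofLp := by
  rw [EuclideanSpace.inner_eq_star_dotProduct, star_trivial, dotProduct_comm]

/-- Bernoulli's inequality `1 + c w ≤ (1 + w)^c`; it moves every constant out of the logarithms
below. -/
lemma log_one_add_mul_le {c w : ℝ} (hc : 1 ≤ c) (hw : 0 ≤ w) :
    Real.log (1 + c * w) ≤ c * Real.log (1 + w) := by
  rw [← Real.log_rpow (by positivity)]
  exact Real.log_le_log (by positivity) (one_add_mul_self_le_rpow_one_add (by linarith) hc)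

lemma hatA_eq (p : Params) (st : State d) :
    hatA p st = (p.lam + st.counter) • (1 : Matrix (Fin d) (Fin d) ℝ) + st.gram := by
  rw [hatA, add_comm]

lemma rankBound_pos (p : Params) (st : State d) : 0 < rankBound p st := by
  have : 0 < st.activeLen := st.active.len_pos
  unfold rankBound
  split_ifs <;> omega

namespace State.Inv

lemma posDef_hatA (h : State.Inv p.l₀ p.ε x t st) (hlam : 0 < p.lam) : (hatA p st).PosDef := by
  rw [hatA_eq]
  exact posDef_smul_one_add (add_pos_of_pos_of_nonneg hlam h.counter_nonneg') h.posSemidef_gram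

lemma rank_gram_le_rankBound (h : State.Inv p.l₀ p.ε x t st) :
    st.gram.rank ≤ rankBound p st := by
  unfold rankBound
  split_ifs with hl
  · refine le_trans (Matrix.rank_le_card_width _) ?_
    simp
  · exact h.rank_gram_le_of_not_limit hl

lemma rankBound_le (h : State.Inv p.l₀ p.ε x t st) :
    rankBound p st ≤ 2 * (2 * st.activeLen) := by
  unfold rankBound
  split_ifs with hl
  · have := h.lt_of_limitReached hl
    omega
  · omega

lemma trace_gram_le (h : State.Inv p.l₀ p.ε x t st) (hx : ∀ s < t, ‖x s‖ ≤ p.L) :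
    st.gram.trace + st.weightedCounter ≤ t * p.L ^ 2 := by
  rw [h.trace_eq]
  calc ∑ s ∈ Finset.range t, ‖x s‖ ^ 2 ≤ ∑ s ∈ Finset.range t, p.L ^ 2 :=
        Finset.sum_le_sum fun s hs =>
          pow_le_pow_left₀ (norm_nonneg _) (hx s (Finset.mem_range.1 hs)) 2
    _ = t * p.L ^ 2 := by simp

/-- This explains `hTerm`: the trace of the Gram matrix is the sum of the squared row norms less `∑
lᵢ σ̄ᵢ`. The remaining summand `α / λ` of the radius is slack. -/
lemma one_add_trace_le (h : State.Inv p.l₀ p.ε x t st) (hlam : 0 < p.lam)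
    (hx : ∀ s < t, ‖x s‖ ≤ p.L) :
    1 + st.gram.trace / (rankBound p st * (p.lam + st.counter)) ≤
      1 + t * p.L ^ 2 / (rankBound p st * p.lam) + hTerm p st / p.lam := by
  have hρ : (0 : ℝ) < rankBound p st := by exact_mod_cast rankBound_pos p st
  have hc := h.counter_nonneg'
  have htr := h.posSemidef_gram.trace_nonneg
  have h1 : st.gram.trace / (rankBound p st * (p.lam + st.counter))
      ≤ st.gram.trace / (rankBound p st * p.lam) := by
    gcongr
    linarith
  have h2 : st.gram.trace / (rankBound p st * p.lam) ≤
      (t * p.L ^ 2 - st.weightedCounter) / (rankBound p st * p.lam) := by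
    gcongr
    linarith [h.trace_gram_le hx]
  have h3 : t * p.L ^ 2 / (rankBound p st * p.lam) + hTerm p st / p.lam
      = (t * p.L ^ 2 - st.weightedCounter) / (rankBound p st * p.lam) + st.counter / p.lam := by
    have : hTerm p st = st.counter - st.weightedCounter / rankBound p st := rfl
    rw [this]
    field_simp
    ring
  have h4 : 0 ≤ st.counter / p.lam := by positivity
  linarith

/-- The log-determinant of the sketched covariance matrix. -/
lemma log_det_hatA_le (h : State.Inv p.l₀ p.ε x t st) (hlam : 0 < p.lam)
    (hx : ∀ s < t, ‖x s‖ ≤ p.L) :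
    Real.log (hatA p st).det ≤ d * Real.log (p.lam + st.counter) +
      rankBound p st * Real.log (1 + t * p.L ^ 2 / (rankBound p st * p.lam)
        + hTerm p st / p.lam) := by
  have hc := h.counter_nonneg'
  have h1 := log_det_le_of_rank_le h.posSemidef_gram (c := p.lam + st.counter) (by positivity)
    (rankBound_pos p st) h.rank_gram_le_rankBound
  rw [hatA_eq]
  rw [Fintype.card_fin] at h1
  refine h1.trans ?_
  have htr := h.posSemidef_gram.trace_nonneg
  have h2 := h.one_add_trace_le hlam hx
  gcongr

lemma log_add_counter (h : State.Inv p.l₀ p.ε x t st) (hlam : 0 < p.lam) :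
    Real.log (p.lam + st.counter) = Real.log p.lam + Real.log (1 + st.counter / p.lam) := by
  have hc := h.counter_nonneg'
  rw [← Real.log_mul hlam.ne' (by positivity)]
  congr 1
  field_simp

/-- The confidence ellipsoid: if the noise is controlled, the sketched estimator is accurate. -/
lemma abs_inner_hatTheta_sub_le (h : State.Inv p.l₀ p.ε x t st) (hlam : 0 < p.lam) (hR : 0 ≤ p.R)
    (hx : ∀ s < t, ‖x s‖ ≤ p.L) {θ : Vec d} (hθ : ‖θ‖ ≤ p.H) {z : ℕ → ℝ}
    (hz : noiseSum x z t ⬝ᵥ ((design p.lam x t)⁻¹ *ᵥ noiseSum x z t) ≤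
      p.R ^ 2 * (2 * Real.log (1 / p.δ)
        + (Real.log (design p.lam x t).det - d * Real.log p.lam))) (y : Vec d) :
    |inner ℝ y (hatTheta p st x (fun s => inner ℝ (x s) θ + z s) t) - inner ℝ y θ| ≤
      radius p t st * matNorm (hatA p st)⁻¹ y := by
  have hA := h.posDef_hatA hlam
  have hD := posDef_design hlam x t
  have hc := h.counter_nonneg'
  set X := ∑ s ∈ Finset.range t, Matrix.vecMulVec (x s).ofLp (x s).ofLp with hX
  set S := noiseSum x z t with hS
  have hXpsd : X.PosSemidef := Matrix.posSemidef_sum _ fun _ _ => posSemidef_vecMulVec _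
  have hAD : (hatA p st - design p.lam x t).PosSemidef := by
    have : hatA p st - design p.lam x t
        = st.gram + st.counter • (1 : Matrix (Fin d) (Fin d) ℝ) - X := by
      rw [hatA, design, add_smul]; abel
    rw [this]
    exact h.lower
  set E := hatA p st - X with hE
  have hEpsd : E.PosSemidef := by
    have : E = (hatA p st - design p.lam x t) + p.lam • (1 : Matrix (Fin d) (Fin d) ℝ) := by
      rw [hE, design]; abel
    rw [this]
    exact hAD.add (Matrix.PosSemidef.one.smul hlam.le)
  have hAE : (hatA p st - E).PosSemidef := by
    have : hatA p st - E = X := by rw [hE]; abel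
    rwa [this]
  have hsum : (∑ s ∈ Finset.range t, (inner ℝ (x s) θ + z s) • x s).ofLp = X *ᵥ θ.ofLp + S := by
    rw [WithLp.ofLp_sum, hX, hS, noiseSum, Matrix.sum_mulVec, ← Finset.sum_add_distrib]
    refine Finset.sum_congr rfl fun s _ => ?_
    rw [Matrix.vecMulVec_mulVec, WithLp.ofLp_smul, add_smul, inner_eq_dotProduct, op_smul_eq_smul]
  have hdiff : inner ℝ y (hatTheta p st x (fun s => inner ℝ (x s) θ + z s) t) - inner ℝ y θ
      = y.ofLp ⬝ᵥ ((hatA p st)⁻¹ *ᵥ S) - y.ofLp ⬝ᵥ ((hatA p st)⁻¹ *ᵥ (E *ᵥ θ.ofLp)) := by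
    rw [inner_eq_dotProduct, inner_eq_dotProduct, hatTheta, hsum, hE, Matrix.sub_mulVec,
      Matrix.mulVec_add, Matrix.mulVec_sub, posDef_inv_mulVec_mulVec hA, dotProduct_add,
      dotProduct_sub]
    ring
  have hquad : S ⬝ᵥ ((hatA p st)⁻¹ *ᵥ S) ≤ p.R ^ 2 * (2 * Real.log (1 / p.δ)
      + d * Real.log (1 + st.counter / p.lam)
      + rankBound p st * Real.log (1 + t * p.L ^ 2 / (rankBound p st * p.lam)
          + hTerm p st / p.lam)) := by
    -- `Â` dominates the exact design matrix, which both decreases the norm of the noise and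
    -- increases the determinant.
    refine (quad_inv_le_quad_inv hD hAD S).trans (hz.trans ?_)
    have h1 := Real.log_le_log hD.det_pos (det_le_det hD hAD)
    have h2 := h.log_det_hatA_le hlam hx
    rw [h.log_add_counter hlam] at h2
    refine mul_le_mul_of_nonneg_left ?_ (sq_nonneg _)
    linarith
  have hnoise : √(S ⬝ᵥ ((hatA p st)⁻¹ *ᵥ S)) ≤ p.R * √(2 * Real.log (1 / p.δ)
      + d * Real.log (1 + st.counter / p.lam)
      + rankBound p st * Real.log (1 + t * p.L ^ 2 / (rankBound p st * p.lam)
          + hTerm p st / p.lam)) := by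
    refine (Real.sqrt_le_sqrt hquad).trans (le_of_eq ?_)
    rw [Real.sqrt_mul (sq_nonneg _), Real.sqrt_sq hR]
  have hbias : √((E *ᵥ θ.ofLp) ⬝ᵥ ((hatA p st)⁻¹ *ᵥ (E *ᵥ θ.ofLp)))
      ≤ p.H * √(p.lam + st.counter) := by
    have h1 := quad_inv_mulVec_le hA hEpsd hAE θ.ofLp
    have h2 : θ.ofLp ⬝ᵥ (E *ᵥ θ.ofLp) ≤ (p.lam + st.counter) * ‖θ‖ ^ 2 := by
      have h3 := quad_le_quad (A := E)
        (B := (p.lam + st.counter) • (1 : Matrix (Fin d) (Fin d) ℝ)) (by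
          have : (p.lam + st.counter) • (1 : Matrix (Fin d) (Fin d) ℝ) - E = X - st.gram := by
            rw [hE, hatA]; abel
          rw [this]
          exact h.upper) θ.ofLp
      rwa [Matrix.smul_mulVec, Matrix.one_mulVec, dotProduct_smul, dotProduct_self_ofLp,
        smul_eq_mul] at h3
    have h4 : (p.lam + st.counter) * ‖θ‖ ^ 2 ≤ p.H ^ 2 * (p.lam + st.counter) := by
      rw [mul_comm]
      gcongr
    refine (Real.sqrt_le_sqrt (h1.trans (h2.trans h4))).trans (le_of_eq ?_)
    rw [Real.sqrt_mul (sq_nonneg _), Real.sqrt_sq ((norm_nonneg _).trans hθ)]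
  have hi := hA.inv.posSemidef
  rw [hdiff, matNorm]
  calc |y.ofLp ⬝ᵥ ((hatA p st)⁻¹ *ᵥ S) - y.ofLp ⬝ᵥ ((hatA p st)⁻¹ *ᵥ (E *ᵥ θ.ofLp))|
      ≤ |y.ofLp ⬝ᵥ ((hatA p st)⁻¹ *ᵥ S)| + |y.ofLp ⬝ᵥ ((hatA p st)⁻¹ *ᵥ (E *ᵥ θ.ofLp))| :=
        abs_sub _ _
    _ ≤ √(y.ofLp ⬝ᵥ ((hatA p st)⁻¹ *ᵥ y.ofLp)) * √(S ⬝ᵥ ((hatA p st)⁻¹ *ᵥ S))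
        + √(y.ofLp ⬝ᵥ ((hatA p st)⁻¹ *ᵥ y.ofLp))
          * √((E *ᵥ θ.ofLp) ⬝ᵥ ((hatA p st)⁻¹ *ᵥ (E *ᵥ θ.ofLp))) :=
        add_le_add (abs_dotProduct_mulVec_le hi _ _) (abs_dotProduct_mulVec_le hi _ _)
    _ = (√(S ⬝ᵥ ((hatA p st)⁻¹ *ᵥ S)) + √((E *ᵥ θ.ofLp) ⬝ᵥ ((hatA p st)⁻¹ *ᵥ (E *ᵥ θ.ofLp))))
        * √(y.ofLp ⬝ᵥ ((hatA p st)⁻¹ *ᵥ y.ofLp)) := by ring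
    _ ≤ radius p t st * √(y.ofLp ⬝ᵥ ((hatA p st)⁻¹ *ᵥ y.ofLp)) := by
        rw [radius]
        exact mul_le_mul_of_nonneg_right (add_le_add hnoise hbias) (Real.sqrt_nonneg _)

/-- One step of the elliptical potential argument, for the potential `log det (Â / (λ + α))`. -/
lemma potential_step (h : State.Inv p.l₀ p.ε x t st) (hlam : 0 < p.lam) {l : ℕ}
    {V : Matrix (Fin d) (Fin l) ℝ} {σ : ℝ} (hs : State.Shrink st (x t) st' V σ) {k : ℝ}
    (hk : (2 * st.activeLen : ℝ) ≤ k) :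
    Real.log (hatA p st).det - d * Real.log (p.lam + st.counter)
        + Real.log (1 + (x t).ofLp ⬝ᵥ ((hatA p st)⁻¹ *ᵥ (x t).ofLp))
      ≤ Real.log (hatA p st').det - d * Real.log (p.lam + st'.counter)
        + k * (Real.log (p.lam + st'.counter) - Real.log (p.lam + st.counter)) := by
  have hA := h.posDef_hatA hlam
  have hc := h.counter_nonneg'
  have hcpos : 0 < p.lam + st.counter := by positivity
  have hu := quad_nonneg hA.inv.posSemidef (x t).ofLp
  have h1 : Real.log (hatA p st).det
      + Real.log (1 + (x t).ofLp ⬝ᵥ ((hatA p st)⁻¹ *ᵥ (x t).ofLp))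
      = Real.log ((p.lam + st.counter) • (1 : Matrix (Fin d) (Fin d) ℝ)
        + (st.gram + Matrix.vecMulVec (x t).ofLp (x t).ofLp)).det := by
    rw [← Real.log_mul hA.det_pos.ne' (by positivity), ← det_add_vecMulVec hA, hatA_eq, add_assoc]
  have h2 : hatA p st' = (p.lam + st.counter) • (1 : Matrix (Fin d) (Fin d) ℝ)
      + (st.gram + Matrix.vecMulVec (x t).ofLp (x t).ofLp) + σ • (1 - V * Vᵀ) := by
    rw [hatA_eq, hs.gram_eq, hs.counter_eq, ← add_assoc, add_smul, smul_sub]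
    abel
  by_cases hσ : σ = 0
  · have h3 : st'.counter = st.counter := by rw [hs.counter_eq, hσ, add_zero]
    rw [h2, hσ, zero_smul, add_zero, ← h1, h3]
    linarith
  -- The log-determinant gains `d - rank` increments of `log (λ + α)` while the normalization
  -- subtracts `d` of them: the net loss is `rank ≤ k` increments.
  · have h3 := log_det_add_compl_ge (h.posSemidef_gram.add (posSemidef_vecMulVec (x t).ofLp))
      hcpos hs.nonneg hs.orthonormal (hs.ker_le hσ)
    rw [← h2, ← h1, Fintype.card_fin] at h3
    have h4 : ((st.gram + Matrix.vecMulVec (x t).ofLp (x t).ofLp).rank : ℝ) ≤ k := by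
      refine le_trans ?_ hk
      exact_mod_cast hs.rank_le hσ
    have h5 : 0 ≤ Real.log (p.lam + st.counter + σ) - Real.log (p.lam + st.counter) :=
      sub_nonneg.2 (Real.log_le_log hcpos (by linarith [hs.nonneg]))
    have h6 := mul_le_mul_of_nonneg_right h4 h5
    rw [hs.counter_eq, ← add_assoc]
    nlinarith

end State.Inv

namespace IsRun

variable {T : ℕ} {arms : ℕ → Set (Vec d)} {r : ℕ → ℝ} {st : ℕ → State d}

lemma inv (hrun : IsRun p T arms x r st) (hε : 0 ≤ p.ε) :
    ∀ t ≤ T, State.Inv p.l₀ p.ε x t (st t) := by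
  intro t
  induction t with
  | zero => intro _; rw [hrun.start]; exact State.Inv.init p.l₀_pos p.ε hε x
  | succ t ih => intro ht; exact ((ih (by omega)).step (hrun.step t (by omega))).1

lemma activeLen_le (hrun : IsRun p T arms x r st) (hε : 0 ≤ p.ε) {t : ℕ} (ht : t ≤ T) :
    (st t).activeLen ≤ (st T).activeLen := by
  have key : ∀ n, t + n ≤ T → (st t).activeLen ≤ (st (t + n)).activeLen := by
    intro n
    induction n with
    | zero => intro _; exact le_rfl
    | succ n ih =>
      intro hn
      obtain ⟨-, l, V, σ, hs⟩ := (hrun.inv hε (t + n) (by omega)).step (hrun.step (t + n) (by omega))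
      exact (ih (by omega)).trans hs.len_le
  have := key (T - t) (by omega)
  rwa [Nat.add_sub_cancel' ht] at this

/-- Telescoping of `potential_step`. Replacing the current length by the final one makes the price
per increment constant, so the shrinking costs sum up exactly. -/
lemma sum_log_le (hrun : IsRun p T arms x r st) (hε : 0 ≤ p.ε) (hlam : 0 < p.lam)
    (hx : ∀ s < T, ‖x s‖ ≤ p.L) :
    ∑ t ∈ Finset.range T, Real.log (1 + (x t).ofLp ⬝ᵥ ((hatA p (st t))⁻¹ *ᵥ (x t).ofLp)) ≤
      rankBound p (st T) * Real.log (1 + T * p.L ^ 2 / (rankBound p (st T) * p.lam)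
        + hTerm p (st T) / p.lam)
      + 2 * (st T).activeLen * Real.log (1 + (st T).counter / p.lam) := by
  have key : ∀ n ≤ T,
      ∑ t ∈ Finset.range n, Real.log (1 + (x t).ofLp ⬝ᵥ ((hatA p (st t))⁻¹ *ᵥ (x t).ofLp)) ≤
      Real.log (hatA p (st n)).det - d * Real.log (p.lam + (st n).counter)
        + 2 * (st T).activeLen * (Real.log (p.lam + (st n).counter) - Real.log p.lam) := by
    intro n
    induction n with
    | zero =>
      intro _
      have h0 : (st 0).counter = 0 := by
        rw [hrun.start, State.counter_eq]; simp [State.init, Block.fresh]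
      have hS : (State.init d p.l₀ p.l₀_pos).active.sketchᵀ
          * (State.init d p.l₀ p.l₀_pos).active.sketch = 0 := State.fresh_gram _ _
      have h1 : (st 0).gram = 0 := by
        rw [hrun.start, State.gram_eq, hS]; simp [State.init, State.inactiveGram]
      rw [hatA_eq, h0, h1]
      simp
    | succ n ih =>
      intro hn
      have hinv := hrun.inv hε n (by omega)
      obtain ⟨-, l, V, σ, hs⟩ := hinv.step (hrun.step n (by omega))
      have hl : (2 * (st n).activeLen : ℝ) ≤ 2 * (st T).activeLen := by
        exact_mod_cast Nat.mul_le_mul_left 2 (hrun.activeLen_le hε (t := n) (by omega))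
      have := hinv.potential_step hlam hs hl
      rw [Finset.sum_range_succ]
      linarith [ih (by omega)]
  have hT := hrun.inv hε T le_rfl
  have h1 := key T le_rfl
  have h2 := hT.log_det_hatA_le hlam hx
  have h3 := hT.log_add_counter hlam
  rw [h3] at h1 h2
  have h4 : Real.log p.lam + Real.log (1 + (st T).counter / p.lam) - Real.log p.lam
      = Real.log (1 + (st T).counter / p.lam) := by ring
  rw [h4] at h1
  linarith

end IsRun

end Regret

/-! ### Comparison of the logarithms and the final bound -/

section RegretBound

variable {d : ℕ} {p : Params} {x : ℕ → Vec d}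

/-- From `u ≤ (1 + u) log (1 + u)` and `1 + u ≤ 2 M`. With `M = L² / λ` this is the source of the
factor `L / √λ` and of the condition `L ≥ √λ`. -/
lemma le_mul_log_one_add {M u : ℝ} (hM : 1 ≤ M) (hu : 0 ≤ u) (huM : u ≤ M) :
    u ≤ 2 * M * Real.log (1 + u) := by
  have h := log_one_add_sub_le le_rfl hu
  simp only [add_zero, Real.log_one, zero_sub, neg_div] at h
  have h1 : u ≤ (1 + u) * Real.log (1 + u) := by
    have : u / (1 + u) ≤ Real.log (1 + u) := by linarith
    rwa [div_le_iff₀' (by positivity)] at this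
  have h2 : 0 ≤ Real.log (1 + u) := Real.log_nonneg (by linarith)
  nlinarith

/-- The argument of the logarithmic factor, minus `1`. -/
noncomputable def logArg (p : Params) (T : ℕ) (st : State d) : ℝ :=
  T * p.L ^ 2 / (2 * st.activeLen * p.lam)
    + (1 - (2 - (st.numBlocks : ℝ)) / 2 ^ (st.numBlocks + 1)) * (p.ε / p.lam)

lemma logFactor_eq (p : Params) (T : ℕ) (st : State d) :
    logFactor p T st = Real.log (1 + logArg p T st) := by
  rw [logFactor, logArg, add_assoc]

/-- The worst case is `B = 1`. The constant `3 / 4` is enough for three times the argument of the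
logarithm to exceed `2 ε / λ`, a bound for `α / λ`. -/
lemma three_quarters_le_blockFactor (st : State d) :
    (3 / 4 : ℝ) ≤ 1 - (2 - (st.numBlocks : ℝ)) / 2 ^ (st.numBlocks + 1) := by
  have hB : 1 ≤ st.numBlocks := by simp [State.numBlocks, State.blocks]
  have h1 : (1 : ℝ) ≤ st.numBlocks := by exact_mod_cast hB
  have h2 : (2 : ℝ) ^ 2 ≤ 2 ^ (st.numBlocks + 1) := pow_le_pow_right₀ (by norm_num) (by omega)
  have h3 : (2 - (st.numBlocks : ℝ)) / 2 ^ (st.numBlocks + 1) ≤ 1 / 4 := by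
    rw [div_le_iff₀ (by positivity)]
    linarith
  linarith

lemma le_logArg (hlam : 0 < p.lam) (hε : 0 ≤ p.ε) (T : ℕ) (st : State d) :
    T * p.L ^ 2 / (2 * st.activeLen * p.lam) + 3 / 4 * (p.ε / p.lam) ≤ logArg p T st := by
  have := three_quarters_le_blockFactor st
  unfold logArg
  gcongr

lemma logArg_nonneg (hlam : 0 < p.lam) (hε : 0 ≤ p.ε) (T : ℕ) (st : State d) :
    0 ≤ logArg p T st :=
  le_trans (by positivity) (le_logArg hlam hε T st)

lemma logFactor_nonneg (hlam : 0 < p.lam) (hε : 0 ≤ p.ε) (T : ℕ) (st : State d) :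
    0 ≤ logFactor p T st := by
  rw [logFactor_eq]
  exact Real.log_nonneg (by linarith [logArg_nonneg hlam hε T st])

/-- Absorbs the confidence term `2 log (1 / δ) = 2 log T` of the radius into `2 l_B Λ`. -/
lemma log_le_logFactor (hlam : 0 < p.lam) (hε : 0 ≤ p.ε) (hL : p.lam ≤ p.L ^ 2) {T : ℕ}
    (hT : 1 ≤ T) (st : State d) :
    Real.log T ≤ 2 * st.activeLen * logFactor p T st := by
  have hl : (1 : ℝ) ≤ st.activeLen := by exact_mod_cast st.active.len_pos
  have hT' : (1 : ℝ) ≤ T := by exact_mod_cast hT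
  have h1 : (T : ℝ) / (2 * st.activeLen) ≤ logArg p T st := by
    refine le_trans ?_ (le_logArg hlam hε T st)
    have : (T : ℝ) / (2 * st.activeLen) ≤ T * p.L ^ 2 / (2 * st.activeLen * p.lam) := by
      rw [div_le_div_iff₀ (by positivity) (by positivity)]
      have : (T : ℝ) * (2 * st.activeLen) * p.lam ≤ T * (2 * st.activeLen) * p.L ^ 2 := by gcongr
      linarith
    have : 0 ≤ 3 / 4 * (p.ε / p.lam) := by positivity
    linarith
  have h2 := log_one_add_mul_le (c := 2 * st.activeLen) (w := T / (2 * st.activeLen))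
    (by linarith) (by positivity)
  rw [mul_div_cancel₀ _ (by positivity)] at h2
  rw [logFactor_eq]
  calc Real.log T ≤ Real.log (1 + T) := Real.log_le_log (by linarith) (by linarith)
    _ ≤ _ := h2
    _ ≤ 2 * st.activeLen * Real.log (1 + logArg p T st) := by gcongr

lemma log_counter_le_logFactor {t : ℕ} {st : State d} (h : State.Inv p.l₀ p.ε x t st)
    (hlam : 0 < p.lam) (hε : 0 ≤ p.ε) (T : ℕ) :
    Real.log (1 + st.counter / p.lam) ≤ 3 * logFactor p T st := by
  have h0 := logArg_nonneg hlam hε T st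
  have hc := h.counter_nonneg'
  rw [logFactor_eq]
  refine le_trans (Real.log_le_log (by positivity) ?_) (log_one_add_mul_le (by norm_num) h0)
  have h1 := le_logArg hlam hε T st
  have h2 : st.counter / p.lam ≤ 2 * (p.ε / p.lam) := by
    rw [← mul_div_assoc]
    gcongr
    exact h.counter_le hε
  have h3 : 0 ≤ T * p.L ^ 2 / (2 * st.activeLen * p.lam) := by positivity
  have h4 : 0 ≤ p.ε / p.lam := by positivity
  linarith

lemma log_counter_le {t : ℕ} {st : State d} (h : State.Inv p.l₀ p.ε x t st)
    (hlam : 0 < p.lam) (hε : 0 ≤ p.ε) :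
    Real.log (1 + st.counter / p.lam) ≤ 2 * Real.log (1 + p.ε / p.lam) := by
  have hc := h.counter_nonneg'
  refine le_trans (Real.log_le_log (by positivity) ?_)
    (log_one_add_mul_le (by norm_num) (by positivity))
  rw [← mul_div_assoc]
  gcongr
  exact h.counter_le hε

/-- The rank term of the confidence radius at any earlier time is bounded by the final
logarithmic factor. -/
lemma rank_term_le {t T : ℕ} {st st' : State d} (h : State.Inv p.l₀ p.ε x t st)
    (hlam : 0 < p.lam) (hε : 0 ≤ p.ε) (hx : ∀ s < t, ‖x s‖ ≤ p.L) (ht : t ≤ T)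
    (hlen : st.activeLen ≤ st'.activeLen) :
    rankBound p st * Real.log (1 + t * p.L ^ 2 / (rankBound p st * p.lam) + hTerm p st / p.lam)
      ≤ 6 * (2 * st'.activeLen * logFactor p T st') := by
  have hρ : (0 : ℝ) < rankBound p st := by exact_mod_cast rankBound_pos p st
  have hl : (1 : ℝ) ≤ st'.activeLen := by exact_mod_cast st'.active.len_pos
  have hρ' : (rankBound p st : ℝ) ≤ 2 * (2 * st'.activeLen) := by
    exact_mod_cast h.rankBound_le.trans (by omega)
  have htr := h.posSemidef_gram.trace_nonneg
  have hc := h.counter_nonneg'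
  have hw := h.weightedCounter_nonneg
  have htT : (t : ℝ) ≤ T := by exact_mod_cast ht
  set w := t * p.L ^ 2 / (rankBound p st * p.lam) + hTerm p st / p.lam with hwdef
  have hw0 : 0 ≤ w := by
    have h1 := h.one_add_trace_le hlam hx
    have : 0 ≤ st.gram.trace / (rankBound p st * (p.lam + st.counter)) := by positivity
    linarith
  have hhT : hTerm p st ≤ 2 * p.ε := by
    have e : hTerm p st = st.counter - st.weightedCounter / rankBound p st := rfl
    have : 0 ≤ st.weightedCounter / rankBound p st := by positivity
    linarith [h.counter_le hε]
  -- The ratio of `4 l_B` (final length) to the current rank bound. Bernoulli with this `c ≥ 1`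
  -- trades the current rank for the final one; the factor `6` is `2` from `4 l_B = 2 (2 l_B)` times
  -- `3` from the logarithm.
  set c := 2 * (2 * (st'.activeLen : ℝ)) / rankBound p st with hcdef
  have hc1 : 1 ≤ c := by rw [hcdef, one_le_div hρ]; exact hρ'
  have hcpos : 0 < c := by linarith
  have h1 := log_one_add_mul_le (w := w / c) hc1 (by positivity)
  rw [mul_div_cancel₀ _ hcpos.ne'] at h1
  have h2 : w / c ≤ 3 * logArg p T st' := by
    have e1 : t * p.L ^ 2 / (rankBound p st * p.lam) / c
        ≤ T * p.L ^ 2 / (2 * st'.activeLen * p.lam) := by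
      have : t * p.L ^ 2 / (rankBound p st * p.lam) / c
          = t * p.L ^ 2 / (2 * (2 * st'.activeLen) * p.lam) := by
        rw [hcdef]; field_simp
      rw [this]
      gcongr
      linarith
    have e2 : hTerm p st / p.lam / c ≤ 2 * (p.ε / p.lam) := by
      rw [div_le_iff₀ hcpos]
      have : hTerm p st / p.lam ≤ 2 * (p.ε / p.lam) := by
        rw [← mul_div_assoc]; gcongr
      have : 0 ≤ 2 * (p.ε / p.lam) := by positivity
      nlinarith
    have e3 := le_logArg hlam hε T st'
    have e4 : 0 ≤ T * p.L ^ 2 / (2 * st'.activeLen * p.lam) := by positivity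
    have e5 : 0 ≤ p.ε / p.lam := by positivity
    rw [hwdef, add_div]
    linarith
  have h0 := logArg_nonneg hlam hε T st'
  have h3 : Real.log (1 + w / c) ≤ 3 * logFactor p T st' := by
    rw [logFactor_eq]
    refine le_trans (Real.log_le_log (by positivity) ?_) (log_one_add_mul_le (by norm_num) h0)
    linarith
  rw [add_assoc, ← hwdef]
  calc rankBound p st * Real.log (1 + w) ≤ rankBound p st * (c * Real.log (1 + w / c)) := by gcongr
    _ ≤ rankBound p st * (c * (3 * logFactor p T st')) := by gcongr
    _ = 6 * (2 * st'.activeLen * logFactor p T st') := by rw [hcdef]; field_simp; ring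

lemma radius_le {t T : ℕ} {st st' : State d} (h : State.Inv p.l₀ p.ε x t st)
    (hlam : 0 < p.lam) (hε : 0 ≤ p.ε) (hR : 0 ≤ p.R) (hH : 0 ≤ p.H) (hL : p.lam ≤ p.L ^ 2)
    (hδ : p.δ = 1 / (T : ℝ)) (hT : 1 ≤ T) (hx : ∀ s < t, ‖x s‖ ≤ p.L) (ht : t ≤ T)
    (hlen : st.activeLen ≤ st'.activeLen) :
    radius p t st ≤ 3 * (p.H * √(p.lam + p.ε)
      + p.R * √(d * Real.log (1 + p.ε / p.lam) + 2 * st'.activeLen * logFactor p T st')) := by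
  have h1 := rank_term_le h hlam hε hx ht hlen
  have h2 := log_counter_le h hlam hε
  have h3 := log_le_logFactor hlam hε hL hT st'
  have hΛ := logFactor_nonneg hlam hε T st'
  have hlog : 0 ≤ Real.log (1 + p.ε / p.lam) :=
    Real.log_nonneg (by have : 0 ≤ p.ε / p.lam := by positivity
                        linarith)
  have hδ' : Real.log (1 / p.δ) = Real.log T := by rw [hδ, one_div_one_div]
  have h4 : (d : ℝ) * Real.log (1 + st.counter / p.lam)
      ≤ d * (2 * Real.log (1 + p.ε / p.lam)) := by gcongr
  -- Under the root, the terms add up to at most `2 + 6 = 8` times `2 l_B Λ` and `2` times `d log (1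
  -- + ε / λ)`; `9` is the next square.
  have h9 : √(9 : ℝ) = 3 := by
    rw [show (9 : ℝ) = 3 ^ 2 by norm_num, Real.sqrt_sq (by norm_num)]
  have hm : 0 ≤ 2 * st'.activeLen * logFactor p T st' := by positivity
  have hd : 0 ≤ d * Real.log (1 + p.ε / p.lam) := by positivity
  have h5 : √(2 * Real.log (1 / p.δ) + d * Real.log (1 + st.counter / p.lam)
      + rankBound p st * Real.log (1 + t * p.L ^ 2 / (rankBound p st * p.lam)
          + hTerm p st / p.lam))
      ≤ 3 * √(d * Real.log (1 + p.ε / p.lam) + 2 * st'.activeLen * logFactor p T st') := by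
    rw [← h9, ← Real.sqrt_mul (by norm_num)]
    refine Real.sqrt_le_sqrt ?_
    rw [hδ']
    linarith
  have h6 : √(p.lam + st.counter) ≤ 3 * √(p.lam + p.ε) := by
    rw [← h9, ← Real.sqrt_mul (by norm_num)]
    refine Real.sqrt_le_sqrt ?_
    linarith [h.counter_le hε]
  rw [radius]
  have h7 := mul_le_mul_of_nonneg_left h5 hR
  have h8 := mul_le_mul_of_nonneg_left h6 hH
  linarith

lemma matNorm_sq_le {t : ℕ} {st : State d} (h : State.Inv p.l₀ p.ε x t st) (hlam : 0 < p.lam)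
    {y : Vec d} (hy : ‖y‖ ≤ p.L) : y.ofLp ⬝ᵥ ((hatA p st)⁻¹ *ᵥ y.ofLp) ≤ p.L ^ 2 / p.lam := by
  have hc := h.counter_nonneg'
  have h1 : (p.lam • (1 : Matrix (Fin d) (Fin d) ℝ)).PosDef := Matrix.PosDef.one.smul hlam
  have h2 : (hatA p st - p.lam • (1 : Matrix (Fin d) (Fin d) ℝ)).PosSemidef := by
    have : hatA p st - p.lam • (1 : Matrix (Fin d) (Fin d) ℝ)
        = st.gram + st.counter • (1 : Matrix (Fin d) (Fin d) ℝ) := by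
      rw [hatA, add_smul]; abel
    rw [this]
    exact h.posSemidef_gram.add (Matrix.PosSemidef.one.smul hc)
  have h3 : (p.lam • (1 : Matrix (Fin d) (Fin d) ℝ))⁻¹ = p.lam⁻¹ • 1 := by
    refine Matrix.inv_eq_left_inv ?_
    rw [Matrix.smul_mul, Matrix.one_mul, smul_smul, inv_mul_cancel₀ hlam.ne', one_smul]
  have h4 := quad_inv_le_quad_inv h1 h2 y.ofLp
  rw [h3, Matrix.smul_mulVec, Matrix.one_mulVec, dotProduct_smul, dotProduct_self_ofLp,
    smul_eq_mul, inv_mul_eq_div] at h4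
  refine h4.trans ?_
  gcongr

/-- The regret bound on the event that the noise is controlled. -/
theorem IsRun.regret_le {T : ℕ} {arms : ℕ → Set (Vec d)} {z : ℕ → ℝ} {st : ℕ → State d}
    {θ : Vec d} (hrun : IsRun p T arms x (fun t => inner ℝ (x t) θ + z t) st)
    (hT : 1 ≤ T) (hlam : 0 < p.lam) (hε : 0 ≤ p.ε) (hR : 0 ≤ p.R) (hL : √p.lam ≤ p.L)
    (hδ : p.δ = 1 / (T : ℝ)) (hθ : ‖θ‖ ≤ p.H) (harms : ∀ t < T, ∀ y ∈ arms t, ‖y‖ ≤ p.L)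
    (hz : ∀ t ≤ T, noiseSum x z t ⬝ᵥ ((design p.lam x t)⁻¹ *ᵥ noiseSum x z t) ≤
      p.R ^ 2 * (2 * Real.log (1 / p.δ)
        + (Real.log (design p.lam x t).det - d * Real.log p.lam))) :
    regret θ T arms x ≤ 30 * regretBound p T (st T) := by
  have hx : ∀ s < T, ‖x s‖ ≤ p.L := fun s hs => harms s hs _ (hrun.mem s hs)
  have hH : 0 ≤ p.H := (norm_nonneg _).trans hθ
  have hsl : 0 < √p.lam := Real.sqrt_pos.2 hlam
  have hL0 : 0 < p.L := hsl.trans_le hL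
  have hL2 : p.lam ≤ p.L ^ 2 := by
    have := pow_le_pow_left₀ hsl.le hL 2
    rwa [Real.sq_sqrt hlam.le] at this
  set Λ := logFactor p T (st T) with hΛdef
  have hΛ : 0 ≤ Λ := logFactor_nonneg hlam hε T (st T)
  set k : ℝ := 2 * (st T).activeLen with hk
  have hk0 : 0 ≤ k := by positivity
  set Bf := p.H * √(p.lam + p.ε) + p.R * √(d * Real.log (1 + p.ε / p.lam) + k * Λ) with hBf
  have hBf0 : 0 ≤ Bf := by positivity
  let u : ℕ → ℝ := fun t => (x t).ofLp ⬝ᵥ ((hatA p (st t))⁻¹ *ᵥ (x t).ofLp)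
  have hu0 : ∀ t ≤ T, 0 ≤ u t := fun t ht =>
    quad_nonneg ((hrun.inv hε t ht).posDef_hatA hlam).inv.posSemidef _
  -- Optimism bounds the instantaneous regret by twice the radius times the norm of the arm, and the
  -- radius is at most `3 Bf`.
  have hinst : ∀ t < T, sSup ((fun y => inner ℝ y θ) '' arms t) - inner ℝ (x t) θ
      ≤ 6 * Bf * √(u t) := by
    intro t ht
    have hinv := hrun.inv hε t ht.le
    have hconf := hinv.abs_inner_hatTheta_sub_le hlam hR (fun s hs => hx s (by omega)) hθ
      (hz t ht.le)
    have hrad := radius_le hinv hlam hε hR hH hL2 hδ hT (fun s hs => hx s (by omega)) ht.le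
      (hrun.activeLen_le hε ht.le)
    have hsup : sSup ((fun y => inner ℝ y θ) '' arms t)
        ≤ ucb p (st t) x (fun t => inner ℝ (x t) θ + z t) t (x t) := by
      refine csSup_le ⟨_, x t, hrun.mem t ht, rfl⟩ ?_
      rintro _ ⟨y, hy, rfl⟩
      refine le_trans ?_ (hrun.optimistic t ht y hy)
      have := (abs_le.1 (hconf y)).1
      unfold ucb
      simp only
      linarith
    have h1 := (abs_le.1 (hconf (x t))).2
    have h2 : matNorm (hatA p (st t))⁻¹ (x t) = √(u t) := rfl
    unfold ucb at hsup
    rw [h2] at h1 hsup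
    have h3 := mul_le_mul_of_nonneg_right hrad (Real.sqrt_nonneg (u t))
    linarith
  have hlog := hrun.sum_log_le hε hlam hx
  have hinvT := hrun.inv hε T le_rfl
  have h1 := rank_term_le hinvT hlam hε hx le_rfl (le_refl (st T).activeLen)
  have h2 := mul_le_mul_of_nonneg_left (log_counter_le_logFactor hinvT hlam hε T) hk0
  -- The constant is `6` from the rank term plus `3` from the counter term.
  have hlog' : ∑ t ∈ Finset.range T, Real.log (1 + u t) ≤ 9 * (k * Λ) := by linarith
  have hM : 1 ≤ p.L ^ 2 / p.lam := by rwa [one_le_div hlam]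
  -- The constant `2 * 9 = 18` is rounded up to the square `25`, whose root `5` gives the final `30
  -- = 6 * 5`.
  have hsumu : ∑ t ∈ Finset.range T, u t ≤ 25 * (p.L ^ 2 / p.lam * (k * Λ)) := by
    calc ∑ t ∈ Finset.range T, u t
        ≤ ∑ t ∈ Finset.range T, 2 * (p.L ^ 2 / p.lam) * Real.log (1 + u t) :=
          Finset.sum_le_sum fun t ht => by
            have ht' := Finset.mem_range.1 ht
            exact le_mul_log_one_add hM (hu0 t ht'.le)
              (matNorm_sq_le (hrun.inv hε t ht'.le) hlam (hx t ht'))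
      _ = 2 * (p.L ^ 2 / p.lam) * ∑ t ∈ Finset.range T, Real.log (1 + u t) := by
          rw [Finset.mul_sum]
      _ ≤ 2 * (p.L ^ 2 / p.lam) * (9 * (k * Λ)) := by gcongr
      _ ≤ 25 * (p.L ^ 2 / p.lam * (k * Λ)) := by
          have : 0 ≤ p.L ^ 2 / p.lam * (k * Λ) := by positivity
          linarith
  have hsqrt : ∑ t ∈ Finset.range T, √(u t) ≤ 5 * (p.L / √p.lam * √T * √(k * Λ)) := by
    have hcs : (∑ t ∈ Finset.range T, √(u t)) ^ 2 ≤ T * ∑ t ∈ Finset.range T, u t := by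
      have := sq_sum_le_card_mul_sum_sq (s := Finset.range T) (f := fun t => √(u t))
      rw [Finset.card_range] at this
      refine this.trans (le_of_eq ?_)
      congr 1
      exact Finset.sum_congr rfl fun t ht =>
        Real.sq_sqrt (hu0 t (Finset.mem_range.1 ht).le)
    refine (pow_le_pow_iff_left₀ (Finset.sum_nonneg fun _ _ => Real.sqrt_nonneg _) (by positivity)
      two_ne_zero).1 ?_
    refine hcs.trans ((mul_le_mul_of_nonneg_left hsumu (Nat.cast_nonneg T)).trans (le_of_eq ?_))
    rw [mul_pow, mul_pow, mul_pow, div_pow, Real.sq_sqrt hlam.le, Real.sq_sqrt (Nat.cast_nonneg T),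
      Real.sq_sqrt (by positivity)]
    ring
  calc regret θ T arms x ≤ ∑ t ∈ Finset.range T, 6 * Bf * √(u t) :=
        Finset.sum_le_sum fun t ht => hinst t (Finset.mem_range.1 ht)
    _ = 6 * Bf * ∑ t ∈ Finset.range T, √(u t) := by rw [Finset.mul_sum]
    _ ≤ 6 * Bf * (5 * (p.L / √p.lam * √T * √(k * Λ))) := by gcongr
    _ = 30 * regretBound p T (st T) := by rw [regretBound, ← hΛdef, ← hk, ← hBf]; ring

end RegretBound

end DBS

/-! ### The high-probability statement -/

theorem mainTheorem2 :
    ∃ C : ℝ, 0 < C ∧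
      ∀ {Ω : Type*} {m₀ : MeasurableSpace Ω} (μ : Measure Ω) [IsProbabilityMeasure μ]
        (ℱ : Filtration ℕ m₀) (d T : ℕ) (p : DBS.Params)
        (θ : DBS.Vec d) (arms : ℕ → Ω → Set (DBS.Vec d)) (x : ℕ → Ω → DBS.Vec d)
        (z : ℕ → Ω → ℝ) (st : ℕ → Ω → DBS.State d),
        1 ≤ T → 0 < p.lam → 0 ≤ p.ε → 0 ≤ p.R → √p.lam ≤ p.L → p.δ = 1 / (T : ℝ) →
        ‖θ‖ ≤ p.H →
        (∀ t < T, ∀ ω, ∀ y ∈ arms t ω, ‖y‖ ≤ p.L) →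
        (∀ t < T, StronglyMeasurable[ℱ t] (x t)) →
        (∀ t < T, StronglyMeasurable[ℱ (t + 1)] (z t)) →
        (∀ t < T, DBS.CondSubgaussian μ (ℱ t) (z t) p.R) →
        (∀ ω, DBS.IsRun p T (fun t => arms t ω) (fun t => x t ω)
          (fun t => inner ℝ (x t ω) θ + z t ω) (fun t => st t ω)) →
        μ {ω | ¬ DBS.regret θ T (fun t => arms t ω) (fun t => x t ω)
            ≤ C * DBS.regretBound p T (st T ω)} ≤ ENNReal.ofReal (1 / (T : ℝ)) := by
  refine ⟨30, by norm_num, ?_⟩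
  intro Ω m₀ μ _ ℱ d T p θ arms x z st hT hlam hε hR hL hδ hθ harms hx hz hsub hrun
  have hTpos : (0 : ℝ) < T := by exact_mod_cast hT
  have hδpos : 0 < p.δ := by rw [hδ]; positivity
  rw [← hδ]
  -- The failure event need not be measurable; it is contained in the event that the noise leaves
  -- its ellipsoid at some time `t ≤ T`.
  refine le_trans (measure_mono ?_)
    (DBS.measure_exists_lt_quad_noiseSum (μ := μ) hlam hR hx hz hsub hδpos)
  intro ω hω
  by_contra hgood
  refine hω ((hrun ω).regret_le hT hlam hε hR hL hδ hθ (fun t ht => harms t ht ω) ?_)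
  intro t ht
  by_contra! hlt
  exact hgood ⟨t, ht, hlt⟩
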